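/- Let $0<\sigma<1/2$. There is a constant $C_\sigma$, depending only on $\sigma$, such that the following holds for every $m\in\mathbb N$. Write $M_m(\mathbb R)$ for the real $m\times m$ matrices with the Euclidean (Frobenius) norm $|\cdot|$. Let $K\in L^1_{loc}(\mathbb R^2,M_m(\mathbb R))$ be such that $(-\Delta)^{\sigma/2}K\in A^{-\sigma}_{2,2}(\mathbb R^2)$ in the following sense. There is a measurable $G=(-\Delta)^{\sigma/2}K:\mathbb R^2\to M_m(\mathbb R)$ such that, for a.e. $h\in\mathbb R$, $(-\Delta)^{\sigma/2}$ applied (entrywise) to the function $x\mapsto K(x,x+h)$ is the function $x\mapsto G(x,x+h)$, and $$\|(-\Delta)^{\sigma/2}K\|_{A^{-\sigma}_{2,2}}:=\Big(\int_{\mathbb R}|h|^{1+2\sigma}\,\|G(\cdot,\cdot+h)\|_{L^2(\mathbb R)}^2\,dh\Big)^{1/2}<\infty .$$ Here $(-\Delta)^{\sigma/2}f=g$ for functions $f,g\in L^1_{loc}(\mathbb R)$ means that $f$ and $g$ define tempered distributions whose Fourier transforms are locally integrable functions with $\hat g(\xi)=(2\pi|\xi|)^\sigma\hat f(\xi)$,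 where $\hat f(\xi)=\int e^{-2\pi i x\xi}f(x)\,dx$ for integrable $f$. Let $P\in\dot H^{1/2}(\mathbb R,M_m(\mathbb R))$, that is, $P\in L^1_{loc}(\mathbb R,M_m(\mathbb R))$ and $$\|P\|_{\dot H^{1/2}}:=\Big(\int_{\mathbb R}\int_{\mathbb R}\frac{|P(x+h)-P(x)|^2}{|h|^2}\,dx\,dh\Big)^{1/2}<\infty .$$ Then for a.e. $x\in\mathbb R$ the function $y\mapsto (P(x)-P(y))K^t(x,y)$ is integrable on $\mathbb R$, where $K^t(x,y)$ is the transpose of the matrix $K(x,y)$; the function $x\mapsto\int_{\mathbb R}(P(x)-P(y))K^t(x,y)\,dy$ belongs to the Lorentz space $L^{2,1}(\mathbb R)$, and $$\Big\|\int_{\mathbb R}(P(x)-P(y))K^t(x,y)\,dy\Big\|_{L^{2,1}(\mathbb R)}\le C_\sigma\,\|(-\Delta)^{\sigma/2}K\|_{A^{-\sigma}_{2,2}}\,\|P\|_{\dot H^{1/2}} .$$ Here $\|f\|_{L^{2,1}}=\int_0^\infty t^{-1/2}f^*(t)\,dt$, where $f^*(t)=\inf\{s\ge0:|\{x:|f(x)|>s\}|\le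 t\}$. -/

import Mathlib

open MeasureTheory Filter Topology
open scoped ENNReal NNReal Matrix SchwartzMap FourierTransform

-- Square matrices carry the Euclidean (Frobenius, Hilbert–Schmidt) norm; their topology is the one
-- of this norm (which is the entrywise topology).
attribute [-instance] instTopologicalSpaceMatrix Matrix.instUniformSpace
attribute [local instance] Matrix.frobeniusNormedAddCommGroup Matrix.frobeniusNormedSpace

noncomputable section

namespace MultiComm

/-! ### Lorentz spaces -/

/-- The decreasing rearrangement `f*(t) = inf {s ≥ 0 : |{|f| > s}| ≤ t}` of a function on the line
(with `inf ∅ = ∞`). -/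
def rearrangement {E : Type*} [NormedAddCommGroup E] (f : ℝ → E) (t : ℝ) : ℝ≥0∞ :=
  sInf {s : ℝ≥0∞ | volume {x : ℝ | s < ‖f x‖ₑ} ≤ ENNReal.ofReal t}

/-- The Lorentz quasi-norm `‖f‖_{L^{p,q}} = (∫₀^∞ (t^{1/p} f*(t))^q dt/t)^{1/q}`
for finite exponents `p, q > 0`. -/
def lorentzNorm {E : Type*} [NormedAddCommGroup E] (p q : ℝ) (f : ℝ → E) : ℝ≥0∞ :=
  (∫⁻ t in Set.Ioi (0 : ℝ),
    (ENNReal.ofReal (t ^ (1 / p)) * rearrangement f t) ^ q * ENNReal.ofReal (1 / t)) ^ (1 / q)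

/-- Membership in the Lorentz space `L^{p,q}(ℝ)`. -/
def MemLorentz {E : Type*} [NormedAddCommGroup E] (p q : ℝ) (f : ℝ → E) : Prop :=
  AEStronglyMeasurable f volume ∧ lorentzNorm p q f < ∞

/-! ### Homogeneous Besov and Sobolev spaces -/

/-- The homogeneous Besov seminorm
`‖f‖_{Ḃ^s_{p,q}} = (∫ |h|^{-1-sq} ‖f(· + h) - f‖_{L^p}^q dh)^{1/q}` on the line. -/
def besovSeminorm {E : Type*} [NormedAddCommGroup E] (s p q : ℝ) (f : ℝ → E) : ℝ≥0∞ :=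
  (∫⁻ h : ℝ, ENNReal.ofReal (|h| ^ (-1 - s * q)) *
    (eLpNorm (fun x => f (x + h) - f x) (ENNReal.ofReal p) volume) ^ q) ^ (1 / q)

/-- The seminorm of `Ḣ^{1/2}(ℝ) = Ḃ^{1/2}_{2,2}(ℝ)`, that is
`(∫∫ |f(x + h) - f(x)|² / |h|² dx dh)^{1/2}`. -/
def sobolevHalfSeminorm {E : Type*} [NormedAddCommGroup E] (f : ℝ → E) : ℝ≥0∞ :=
  besovSeminorm (1 / 2) 2 2 f

/-- Membership in `Ḣ^{1/2}(ℝ)`. -/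
def MemSobolevHalf {E : Type*} [NormedAddCommGroup E] (f : ℝ → E) : Prop :=
  LocallyIntegrable f volume ∧ sobolevHalfSeminorm f < ∞

/-! ### Schwartz kernels -/

/-- The slice `x ↦ K(x, x + h)` of a kernel. -/
def slice {E : Type*} (K : ℝ × ℝ → E) (h : ℝ) : ℝ → E := fun x => K (x, x + h)

/-- The norm of the Besov type space of Schwartz kernels,
`‖K‖_{A^s_{p,q}} = (∫ |h|^{1-qs} ‖K(·, · + h)‖_{L^p}^q dh)^{1/q}`. -/
def kernelNorm {E : Type*} [NormedAddCommGroup E] (s p q : ℝ) (K : ℝ × ℝ → E) : ℝ≥0∞ :=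
  (∫⁻ h : ℝ, ENNReal.ofReal (|h| ^ (1 - q * s)) *
    (eLpNorm (slice K h) (ENNReal.ofReal p) volume) ^ q) ^ (1 / q)

/-! ### The fractional Laplacian -/

/-- The function `f` defines a tempered distribution whose Fourier transform is the (locally
integrable) function `F`: `⟨f, 𝓕 φ⟩ = ⟨F, φ⟩` for all Schwartz functions `φ`, all pairings being
absolutely convergent integrals. -/
def IsFourierTransform (f : ℝ → ℝ) (F : ℝ → ℂ) : Prop :=
  LocallyIntegrable f volume ∧ LocallyIntegrable F volume ∧
    ∀ φ : 𝓢(ℝ, ℂ),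
      Integrable (fun x => (f x : ℂ) * (𝓕 φ : 𝓢(ℝ, ℂ)) x) volume ∧
      Integrable (fun ξ => F ξ * φ ξ) volume ∧
      ∫ x, (f x : ℂ) * (𝓕 φ : 𝓢(ℝ, ℂ)) x = ∫ ξ, F ξ * φ ξ

/-- `(-Δ)^{σ/2} f = g` on the line, as a Fourier multiplier: the Fourier transform `F` of `f` is a
locally integrable function and that of `g` is `(2π|ξ|)^σ F(ξ)` (recall that
`𝓕 φ ξ = ∫ exp(-2πixξ) φ(x) dx`). As usual for homogeneous spaces of low order,
local integrability of `F` excludes the nonzero constants, which the multiplier would annihilate. -/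
def HasFracLaplacian (σ : ℝ) (f g : ℝ → ℝ) : Prop :=
  ∃ F : ℝ → ℂ, IsFourierTransform f F ∧
    IsFourierTransform g (fun ξ => (((2 * Real.pi * |ξ|) ^ σ : ℝ) : ℂ) * F ξ)

/-- `(-Δ)^{σ/2} K = G` for matrix valued kernels: the fractional Laplacian acts, for almost every
fixed `h`, on the function `x ↦ K(x, x + h)`, entry by entry. -/
def HasKernelFracLaplacian {m : ℕ} (σ : ℝ) (K G : ℝ × ℝ → Matrix (Fin m) (Fin m) ℝ) : Prop :=
  AEStronglyMeasurable G volume ∧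
    ∀ᵐ h : ℝ, ∀ i j : Fin m,
      HasFracLaplacian σ (fun x => slice K h x i j) (fun x => slice G h x i j)

end MultiComm

end

/-! The proof combines duality for L^{2,1} with a Hardy inequality for rearranged weights. Call a
measurable r ≥ 0 admissible if |{r ≤ a}| ≤ a for all a; the model is r(x) = 2|x|. By
`lorentzNorm_two_one_le_of_forall` it suffices to bound the integral of T r^{-1/2} uniformly over
admissible r, where T(x) = ∫ |P(x) - P(y)| |K(x,y)| dy.

Put y = x + h and split r^{-1/2} = r^{-σ} r^{-(1/2-σ)}. For fixed h, Cauchy–Schwarz in x leaves two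
weighted L² norms. Both are controlled by `weighted_hardy`: for 0 < s < 1/2, ∫ r^{-2s}|u|² is
bounded by the Gagliardo energy of order s, provided the means of u over long intervals tend to 0.
With s = σ and u the slice of K, Plancherel bounds the energy by the L² norm of the slice of G. With
s = 1/2 - σ and u = P(·+h) - P, the energy involves second differences of P, whose squared L² norm
is at most 8 min(B(h), B(t)), where B(t) = ‖P(·+t) - P‖²_{L²}.

Cauchy–Schwarz in h with the weights |h|^{±(1+2σ)/2} then produces the kernel norm of G and a double
integral of min(B(h), B(t)), which `lintegral_lintegral_min_le` bounds by ∫ |h|^{-2} B(h) dh, the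
squared Ḣ^{1/2} seminorm.

The Hardy inequality compares u(x) with its mean at scale r(x) and telescopes through dyadic scales.
The telescoping increments are bounded independently of x, so only the measure of each level set of
r enters. -/

/-! ### Plancherel for transforms defined by duality. -/

theorem ae_eq_of_schwartz_integral_eq {f g : ℝ → ℂ} (hf : LocallyIntegrable f volume)
    (hg : LocallyIntegrable g volume)
    (h : ∀ φ : 𝓢(ℝ, ℂ), ∫ x, f x * φ x = ∫ x, g x * φ x) : f =ᵐ[volume] g := by
  refine ae_eq_of_integral_contDiff_smul_eq hf hg fun ψ hψ hc => ?_
  let Ψ : 𝓢(ℝ, ℂ) := (hc.comp_left (g := fun r : ℝ => (r : ℂ)) (by simp)).toSchwartzMap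
    (Complex.ofRealCLM.contDiff.comp hψ)
  have hΨ : ∀ x, Ψ x = (ψ x : ℂ) := fun _ => rfl
  simpa [mul_comm, hΨ] using h Ψ

theorem integral_Lp_mul_fourier (f : Lp ℂ 2 (volume : Measure ℝ)) (φ : 𝓢(ℝ, ℂ)) :
    ∫ x, f x * (𝓕 φ : 𝓢(ℝ, ℂ)) x = ∫ x, (𝓕 f : Lp ℂ 2 (volume : Measure ℝ)) x * φ x := by
  have h := congrArg (fun T : 𝓢'(ℝ, ℂ) => T φ) (Lp.fourier_toTemperedDistribution_eq f)
  simp only [TemperedDistribution.fourier_apply, Lp.toTemperedDistribution_apply, smul_eq_mul] at h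
  simpa [mul_comm] using h

theorem MeasureTheory.MemLp.locallyIntegrable_two {f : ℝ → ℂ} (hf : MemLp f 2) :
    LocallyIntegrable f volume :=
  hf.locallyIntegrable (by norm_num)

/-- If the distributional Fourier transform of `f` is in `L²`, then so is `f`. -/
theorem ae_eq_fourierInv_of_integral_eq {f H : ℝ → ℂ} (hf : LocallyIntegrable f volume)
    (hH : MemLp H 2)
    (h : ∀ φ : 𝓢(ℝ, ℂ), ∫ x, f x * (𝓕 φ : 𝓢(ℝ, ℂ)) x = ∫ ξ, H ξ * φ ξ) :
    f =ᵐ[volume] (𝓕⁻ (hH.toLp H) : Lp ℂ 2 (volume : Measure ℝ)) := by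
  refine ae_eq_of_schwartz_integral_eq hf (Lp.memLp _).locallyIntegrable_two fun ψ => ?_
  have h1 := h (𝓕⁻ ψ)
  have h2 := integral_Lp_mul_fourier (𝓕⁻ (hH.toLp H) : Lp ℂ 2 (volume : Measure ℝ)) (𝓕⁻ ψ)
  rw [FourierTransform.fourier_fourierInv_eq] at h1 h2
  rw [FourierTransform.fourier_fourierInv_eq] at h2
  rw [h1, h2]
  refine integral_congr_ae ?_
  filter_upwards [hH.coeFn_toLp] with x hx
  rw [hx]

/-- Square integrability is assumed only on the Fourier side. This suits differences of a slice of
K, where the slice itself need not lie in L². -/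
theorem eLpNorm_eq_of_integral_fourier_eq {f H : ℝ → ℂ} (hf : LocallyIntegrable f volume)
    (hH : MemLp H 2)
    (h : ∀ φ : 𝓢(ℝ, ℂ), ∫ x, f x * (𝓕 φ : 𝓢(ℝ, ℂ)) x = ∫ ξ, H ξ * φ ξ) :
    eLpNorm f 2 volume = eLpNorm H 2 volume := by
  rw [eLpNorm_congr_ae (ae_eq_fourierInv_of_integral_eq hf hH h), ← eLpNorm_congr_ae hH.coeFn_toLp,
    ← ENNReal.toReal_eq_toReal_iff' (Lp.memLp _).eLpNorm_ne_top (Lp.memLp _).eLpNorm_ne_top,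
    ← Lp.norm_def, ← Lp.norm_def]
  rw [← Lp.norm_fourier_eq, FourierTransform.fourier_fourierInv_eq]

/-- Plancherel for a square integrable function whose distributional Fourier transform is a
locally integrable function. -/
theorem eLpNorm_fourier_eq_of_integral_eq {f H : ℝ → ℂ} (hf : MemLp f 2)
    (hH : LocallyIntegrable H volume)
    (h : ∀ φ : 𝓢(ℝ, ℂ), ∫ x, f x * (𝓕 φ : 𝓢(ℝ, ℂ)) x = ∫ ξ, H ξ * φ ξ) :
    eLpNorm H 2 volume = eLpNorm f 2 volume := by
  have key : H =ᵐ[volume] (𝓕 (hf.toLp f) : Lp ℂ 2 (volume : Measure ℝ)) := by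
    refine ae_eq_of_schwartz_integral_eq hH (Lp.memLp _).locallyIntegrable_two fun ψ => ?_
    rw [← h, ← integral_Lp_mul_fourier]
    refine integral_congr_ae ?_
    filter_upwards [hf.coeFn_toLp] with x hx
    rw [hx]
  rw [eLpNorm_congr_ae key, ← eLpNorm_congr_ae hf.coeFn_toLp,
    ← ENNReal.toReal_eq_toReal_iff' (Lp.memLp _).eLpNorm_ne_top (Lp.memLp _).eLpNorm_ne_top,
    ← Lp.norm_def, ← Lp.norm_def, Lp.norm_fourier_eq]

/-- Building ψ on the Fourier side, as the inverse transform of a translate of 𝓕 φ, makes the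
Schwartz property automatic. It transfers translations of f to modulations of its transform. -/
theorem exists_schwartz_modulation (t : ℝ) (φ : 𝓢(ℝ, ℂ)) :
    ∃ ψ : 𝓢(ℝ, ℂ), (∀ ξ, ψ ξ = Complex.exp (2 * Real.pi * t * ξ * Complex.I) * φ ξ) ∧
      ∀ x, (𝓕 ψ : 𝓢(ℝ, ℂ)) x = (𝓕 φ : 𝓢(ℝ, ℂ)) (x - t) := by
  refine ⟨𝓕⁻ (SchwartzMap.compSubConstCLM ℂ t (𝓕 φ)), fun ξ => ?_, fun x => ?_⟩
  · have h1 : φ ξ = (𝓕⁻ (𝓕 φ) : 𝓢(ℝ, ℂ)) ξ := by rw [FourierTransform.fourierInv_fourier_eq]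
    rw [h1, SchwartzMap.fourierInv_coe, SchwartzMap.fourierInv_coe, Real.fourierInv_eq',
      Real.fourierInv_eq']
    simp only [SchwartzMap.compSubConstCLM_apply, smul_eq_mul]
    rw [← integral_add_right_eq_self _ t, ← integral_const_mul]
    refine integral_congr_ae (.of_forall fun x => ?_)
    simp only [add_sub_cancel_right, ← mul_assoc, ← Complex.exp_add]
    congr 2
    simp
    ring
  · rw [FourierTransform.fourier_fourierInv_eq]
    simp

/-- The inverse Fourier transform of an integrable function, tested against Schwartz functions. -/
theorem integral_fourierInv_mul_fourier {F : ℝ → ℂ} (hF : Integrable F) (φ : 𝓢(ℝ, ℂ)) :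
    ∫ x, (𝓕⁻ F) x * (𝓕 φ : 𝓢(ℝ, ℂ)) x = ∫ ξ, F ξ * φ ξ := by
  have h := VectorFourier.integral_fourierIntegral_smul_eq_flip (μ := (volume : Measure ℝ))
    (ν := (volume : Measure ℝ)) (L := innerₗ ℝ) (e := Real.fourierChar)
    Real.continuous_fourierChar continuous_inner hF (𝓕⁻ φ : 𝓢(ℝ, ℂ)).integrable
  rw [flip_innerₗ] at h
  change ∫ x, 𝓕 F x • (𝓕⁻ φ : 𝓢(ℝ, ℂ)) x = ∫ x, F x • (𝓕 ((𝓕⁻ φ : 𝓢(ℝ, ℂ)) : ℝ → ℂ)) x at h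
  rw [← SchwartzMap.fourier_coe, FourierTransform.fourier_fourierInv_eq] at h
  simp only [smul_eq_mul] at h
  rw [← h, ← integral_neg_eq_self]
  refine integral_congr_ae (.of_forall fun x => ?_)
  simp only [SchwartzMap.fourierInv_coe, SchwartzMap.fourier_coe, Real.fourierInv_eq_fourier_neg, neg_neg]

/-! ### Power integrals and bounds for the multiplier of a difference. -/

theorem lintegral_mul_sq_le {α : Type*} [MeasurableSpace α] {μ : Measure α} {f g : α → ℝ≥0∞}
    (hf : AEMeasurable f μ) (hg : AEMeasurable g μ) :
    (∫⁻ a, f a * g a ∂μ) ^ 2 ≤ (∫⁻ a, f a ^ 2 ∂μ) * ∫⁻ a, g a ^ 2 ∂μ := by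
  have h := ENNReal.lintegral_mul_le_Lp_mul_Lq μ Real.HolderConjugate.two_two hf hg
  simp only [Pi.mul_apply, ENNReal.rpow_ofNat] at h
  refine (pow_le_pow_left' h 2).trans ?_
  rw [mul_pow, ← ENNReal.rpow_natCast, ← ENNReal.rpow_natCast, ← ENNReal.rpow_mul,
    ← ENNReal.rpow_mul]
  norm_num

theorem lintegral_sq_le_measure_mul {α : Type*} [MeasurableSpace α] {μ : Measure α}
    {f : α → ℝ≥0∞} (hf : AEMeasurable f μ) (s : Set α) :
    (∫⁻ a in s, f a ∂μ) ^ 2 ≤ μ s * ∫⁻ a in s, f a ^ 2 ∂μ := by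
  simpa using lintegral_mul_sq_le (μ := μ.restrict s) (f := fun _ => 1) aemeasurable_const
    hf.restrict

theorem eLpNorm_two_sq {α E : Type*} [MeasurableSpace α] {μ : Measure α} [NormedAddCommGroup E]
    (f : α → E) : eLpNorm f 2 μ ^ 2 = ∫⁻ a, ‖f a‖ₑ ^ 2 ∂μ := by
  have h := eLpNorm_nnreal_pow_eq_lintegral (f := f) (μ := μ) (p := 2) (by norm_num)
  simpa using h

theorem lintegral_Ioo_rpow {p a : ℝ} (hp : -1 < p) (ha : 0 ≤ a) :
    ∫⁻ t in Set.Ioo 0 a, ENNReal.ofReal (t ^ p) = ENNReal.ofReal (a ^ (p + 1) / (p + 1)) := by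
  have h1 := integral_rpow (a := 0) (b := a) (Or.inl hp)
  rw [intervalIntegral.integral_of_le ha, Real.zero_rpow (by linarith), sub_zero,
    integral_Ioc_eq_integral_Ioo] at h1
  rw [← h1, ofReal_integral_eq_lintegral_ofReal]
  · have := intervalIntegral.intervalIntegrable_rpow' (a := 0) (b := a) hp
    rw [intervalIntegrable_iff_integrableOn_Ioo_of_le ha] at this
    exact this
  · filter_upwards [ae_restrict_mem measurableSet_Ioo] with t ht
    exact Real.rpow_nonneg ht.1.le _

theorem lintegral_Ioi_rpow {p a : ℝ} (hp : p < -1) (ha : 0 < a) :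
    ∫⁻ t in Set.Ioi a, ENNReal.ofReal (t ^ p) = ENNReal.ofReal (a ^ (p + 1) / (-(p + 1))) := by
  have h1 := integral_Ioi_rpow_of_lt hp ha
  rw [neg_div, ← div_neg] at h1
  rw [← h1, ofReal_integral_eq_lintegral_ofReal]
  · exact integrableOn_Ioi_rpow_of_lt hp ha
  · filter_upwards [ae_restrict_mem measurableSet_Ioi] with t ht
    exact Real.rpow_nonneg (ha.trans ht).le _

/-- Split at t = 1/a: below it the bound ta is integrable against the weight because s < 1, above it
the bound 2 is integrable because s > 0. With a = 2π|ξ| this is the symbol of the Gagliardo energy.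
-/
theorem lintegral_Ioi_min_sq_mul_rpow_le {s a : ℝ} (hs0 : 0 < s) (hs1 : s < 1) (ha : 0 < a) :
    ∫⁻ t in Set.Ioi (0 : ℝ), ENNReal.ofReal (min (t * a) 2 ^ 2) * ENNReal.ofReal (t ^ (-1 - 2 * s)) ≤
      ENNReal.ofReal (1 / (2 - 2 * s) + 2 / s) * ENNReal.ofReal (a ^ (2 * s)) := by
  have hsub : Set.Ioi (0 : ℝ) ⊆ Set.Ioo 0 a⁻¹ ∪ Set.Ici a⁻¹ := by
    intro t ht
    rcases lt_or_ge t a⁻¹ with h | h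
    · exact Or.inl ⟨ht, h⟩
    · exact Or.inr h
  have ha' : 0 < a⁻¹ := inv_pos.2 ha
  refine (lintegral_mono_set hsub).trans ((lintegral_union_le _ _ _).trans ?_)
  have h1 : ∫⁻ t in Set.Ioo 0 a⁻¹, ENNReal.ofReal (min (t * a) 2 ^ 2) *
      ENNReal.ofReal (t ^ (-1 - 2 * s)) ≤ ENNReal.ofReal (a ^ (2 * s) / (2 - 2 * s)) := by
    calc _ ≤ ∫⁻ t in Set.Ioo 0 a⁻¹, ENNReal.ofReal (a ^ 2) * ENNReal.ofReal (t ^ (1 - 2 * s)) := by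
          refine setLIntegral_mono' measurableSet_Ioo fun t ht => ?_
          rw [← ENNReal.ofReal_mul (by positivity), ← ENNReal.ofReal_mul (by positivity)]
          refine ENNReal.ofReal_le_ofReal ?_
          have h2 : t ^ (1 - 2 * s) = t ^ 2 * t ^ (-1 - 2 * s) := by
            rw [← Real.rpow_natCast, ← Real.rpow_add ht.1]; congr 1; push_cast; ring
          rw [h2, ← mul_assoc]
          have h3 : min (t * a) 2 ≤ t * a := min_le_left _ _
          have h4 : 0 ≤ min (t * a) 2 := le_min (mul_nonneg ht.1.le ha.le) (by norm_num)
          have h5 : 0 ≤ t ^ (-1 - 2 * s) := Real.rpow_nonneg ht.1.le _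
          refine mul_le_mul_of_nonneg_right ?_ h5
          calc _ ≤ (t * a) ^ 2 := pow_le_pow_left₀ h4 h3 2
            _ = _ := by ring
      _ = ENNReal.ofReal (a ^ 2) * ENNReal.ofReal (a⁻¹ ^ (2 - 2 * s) / (2 - 2 * s)) := by
          rw [lintegral_const_mul' _ _ ENNReal.ofReal_ne_top, lintegral_Ioo_rpow (by linarith) ha'.le]
          ring_nf
      _ = _ := by
          rw [← ENNReal.ofReal_mul (by positivity), ← mul_div_assoc]
          congr 2
          rw [Real.inv_rpow ha.le, ← Real.rpow_neg ha.le, ← Real.rpow_natCast, ← Real.rpow_add ha]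
          congr 1; push_cast; ring
  have h2 : ∫⁻ t in Set.Ici a⁻¹, ENNReal.ofReal (min (t * a) 2 ^ 2) *
      ENNReal.ofReal (t ^ (-1 - 2 * s)) ≤ ENNReal.ofReal (2 * a ^ (2 * s) / s) := by
    rw [setLIntegral_congr Ioi_ae_eq_Ici.symm]
    calc _ ≤ ∫⁻ t in Set.Ioi a⁻¹, ENNReal.ofReal 4 * ENNReal.ofReal (t ^ (-1 - 2 * s)) := by
          refine setLIntegral_mono' measurableSet_Ioi fun t ht => ?_
          gcongr
          have h3 : min (t * a) 2 ≤ 2 := min_le_right _ _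
          have h4 : 0 ≤ min (t * a) 2 :=
            le_min (mul_nonneg (ha'.trans ht).le ha.le) (by norm_num)
          nlinarith
      _ = ENNReal.ofReal 4 * ENNReal.ofReal (a⁻¹ ^ (-2 * s) / (2 * s)) := by
          rw [lintegral_const_mul' _ _ ENNReal.ofReal_ne_top, lintegral_Ioi_rpow (by linarith) ha']
          ring_nf
      _ = _ := by
          rw [← ENNReal.ofReal_mul (by positivity), Real.inv_rpow ha.le, ← Real.rpow_neg ha.le]
          congr 1
          field_simp
          ring_nf
  refine (add_le_add h1 h2).trans (le_of_eq ?_)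
  have : 0 < 2 - 2 * s := by linarith
  rw [← ENNReal.ofReal_add (by positivity) (by positivity), ← ENNReal.ofReal_mul (by positivity)]
  congr 1
  field_simp

theorem norm_exp_mul_I_sub_one_le (t ξ : ℝ) :
    ‖Complex.exp (2 * Real.pi * t * ξ * Complex.I) - 1‖ ≤ min (|t| * (2 * Real.pi * |ξ|)) 2 := by
  have e : (2 * Real.pi * t * ξ * Complex.I : ℂ) = Complex.I * ((2 * Real.pi * t * ξ : ℝ) : ℂ) := by
    push_cast; ring
  rw [e]
  refine le_min ?_ ?_
  · refine Real.norm_exp_I_mul_ofReal_sub_one_le.trans (le_of_eq ?_)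
    rw [Real.norm_eq_abs, abs_mul, abs_mul, abs_of_pos Real.two_pi_pos]; ring
  · refine (norm_sub_le _ _).trans ?_
    rw [mul_comm, Complex.norm_exp_ofReal_mul_I]
    norm_num

theorem min_le_two_mul_rpow {x s : ℝ} (hx : 0 ≤ x) (hs0 : 0 < s) (hs1 : s < 1) :
    min x 2 ≤ 2 * x ^ s := by
  rcases le_total x 1 with h | h
  · have := Real.rpow_le_rpow_of_exponent_ge' hx h hs0.le hs1.le
    rw [Real.rpow_one] at this
    have h2 := Real.rpow_nonneg hx s
    exact (min_le_left _ _).trans (by linarith)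
  · have := Real.one_le_rpow h hs0.le
    exact (min_le_right _ _).trans (by linarith)

/-! ### Gagliardo energy bounded by the fractional Laplacian. -/

/-- The distributional Fourier transform of a difference `f (· + t) - f`. -/
theorem integral_translate_sub_mul_fourier {f F : ℝ → ℂ}
    (h : ∀ φ : 𝓢(ℝ, ℂ), Integrable (fun x => f x * (𝓕 φ : 𝓢(ℝ, ℂ)) x) ∧
      Integrable (fun ξ => F ξ * φ ξ) ∧
      ∫ x, f x * (𝓕 φ : 𝓢(ℝ, ℂ)) x = ∫ ξ, F ξ * φ ξ) (t : ℝ) (φ : 𝓢(ℝ, ℂ)) :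
    ∫ x, (f (x + t) - f x) * (𝓕 φ : 𝓢(ℝ, ℂ)) x =
      ∫ ξ : ℝ, (Complex.exp (2 * Real.pi * t * ξ * Complex.I) - 1) * F ξ * φ ξ := by
  obtain ⟨ψ, h1, h2⟩ := exists_schwartz_modulation t φ
  obtain ⟨a1, a2, a3⟩ := h φ
  obtain ⟨b1, b2, b3⟩ := h ψ
  have c1 : Integrable (fun x => f (x + t) * (𝓕 φ : 𝓢(ℝ, ℂ)) x) := by
    have := b1.comp_add_right t
    simpa [h2] using this
  have c2 : ∫ x, f (x + t) * (𝓕 φ : 𝓢(ℝ, ℂ)) x = ∫ x, f x * (𝓕 ψ : 𝓢(ℝ, ℂ)) x := by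
    rw [← integral_add_right_eq_self (fun x => f x * (𝓕 ψ : 𝓢(ℝ, ℂ)) x) t]
    simp [h2]
  simp only [sub_mul, one_mul]
  rw [integral_sub c1 a1, c2, a3, b3, ← integral_sub b2 a2]
  refine integral_congr_ae (.of_forall fun ξ => ?_)
  simp only [h1]
  ring

theorem enorm_exp_sub_one_sq_le (t ξ : ℝ) :
    ‖Complex.exp (2 * Real.pi * t * ξ * Complex.I) - 1‖ₑ ^ 2 ≤
      ENNReal.ofReal (min (|t| * (2 * Real.pi * |ξ|)) 2 ^ 2) := by
  rw [← ofReal_norm, ← ENNReal.ofReal_pow (norm_nonneg _)]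
  exact ENNReal.ofReal_le_ofReal
    (pow_le_pow_left₀ (norm_nonneg _) (norm_exp_mul_I_sub_one_le t ξ) 2)

/-- Interpolating between the bounds |t|·2π|ξ| and 2 gives |e^{2πitξ} - 1| ≤ 2|t|^s (2π|ξ|)^s, which
puts each difference in L² although F need not be. -/
theorem memLp_exp_sub_one_mul {s : ℝ} (hs0 : 0 < s) (hs1 : s < 1) {F : ℝ → ℂ}
    (hF : AEStronglyMeasurable F volume)
    (hG : MemLp (fun ξ => (((2 * Real.pi * |ξ|) ^ s : ℝ) : ℂ) * F ξ) 2) (t : ℝ) :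
    MemLp (fun ξ : ℝ => (Complex.exp (2 * Real.pi * t * ξ * Complex.I) - 1) * F ξ) 2 := by
  refine hG.of_le_mul (c := 2 * |t| ^ s) ?_ (.of_forall fun ξ => ?_)
  · exact AEStronglyMeasurable.mul (Continuous.aestronglyMeasurable (by fun_prop)) hF
  · have hp : 0 ≤ 2 * Real.pi * |ξ| := by positivity
    rw [norm_mul, norm_mul, Complex.norm_real, Real.norm_of_nonneg (Real.rpow_nonneg hp s),
      ← mul_assoc]
    refine mul_le_mul_of_nonneg_right ?_ (norm_nonneg _)
    refine (norm_exp_mul_I_sub_one_le t ξ).trans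
      ((min_le_two_mul_rpow (by positivity) hs0 hs1).trans (le_of_eq ?_))
    rw [Real.mul_rpow (abs_nonneg _) hp, mul_assoc 2 (|t| ^ s)]

/-- The Gagliardo seminorm of order `s` is controlled by the `L²` norm of `(-Δ)^{s/2} f`. -/
theorem lintegral_translate_sub_sq_le {s : ℝ} (hs0 : 0 < s) (hs1 : s < 1) {f F : ℝ → ℂ}
    (hf : LocallyIntegrable f volume) (hF : AEStronglyMeasurable F volume)
    (h : ∀ φ : 𝓢(ℝ, ℂ), Integrable (fun x => f x * (𝓕 φ : 𝓢(ℝ, ℂ)) x) ∧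
      Integrable (fun ξ => F ξ * φ ξ) ∧
      ∫ x, f x * (𝓕 φ : 𝓢(ℝ, ℂ)) x = ∫ ξ, F ξ * φ ξ)
    (hG : MemLp (fun ξ => (((2 * Real.pi * |ξ|) ^ s : ℝ) : ℂ) * F ξ) 2) :
    ∫⁻ t in Set.Ioi (0 : ℝ), (∫⁻ x, ‖f (x + t) - f x‖ₑ ^ 2) * ENNReal.ofReal (t ^ (-1 - 2 * s)) ≤
      ENNReal.ofReal (1 / (2 - 2 * s) + 2 / s) *
        ∫⁻ ξ, ‖(((2 * Real.pi * |ξ|) ^ s : ℝ) : ℂ) * F ξ‖ₑ ^ 2 := by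
  have hloc : ∀ t : ℝ, LocallyIntegrable (fun x => f (x + t) - f x) volume := fun t => by
    refine LocallyIntegrable.sub ?_ hf
    intro x
    obtain ⟨U, hU, hi⟩ := hf (x + t)
    refine ⟨(fun y => y + t) ⁻¹' U, (continuous_add_const t).continuousAt.preimage_mem_nhds hU, ?_⟩
    exact ((measurePreserving_add_right volume t).integrableOn_comp_preimage
      (MeasurableEquiv.addRight t).measurableEmbedding).2 hi
  have hb : ∀ t : ℝ, ∫⁻ x, ‖f (x + t) - f x‖ₑ ^ 2 =
      ∫⁻ ξ : ℝ, ‖Complex.exp (2 * Real.pi * t * ξ * Complex.I) - 1‖ₑ ^ 2 * ‖F ξ‖ₑ ^ 2 := fun t => by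
    rw [← eLpNorm_two_sq, eLpNorm_eq_of_integral_fourier_eq (hloc t)
      (memLp_exp_sub_one_mul hs0 hs1 hF hG t) (integral_translate_sub_mul_fourier h t),
      eLpNorm_two_sq]
    simp only [enorm_mul, mul_pow]
  calc _ ≤ ∫⁻ t in Set.Ioi (0 : ℝ), ∫⁻ ξ : ℝ,
        ENNReal.ofReal (min (|t| * (2 * Real.pi * |ξ|)) 2 ^ 2) * ‖F ξ‖ₑ ^ 2 *
          ENNReal.ofReal (t ^ (-1 - 2 * s)) := by
        refine lintegral_mono fun t => ?_
        rw [hb, ← lintegral_mul_const' _ _ ENNReal.ofReal_ne_top]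
        refine lintegral_mono fun ξ => ?_
        gcongr
        exact enorm_exp_sub_one_sq_le t ξ
    _ = ∫⁻ ξ : ℝ, ∫⁻ t in Set.Ioi (0 : ℝ),
        ENNReal.ofReal (min (|t| * (2 * Real.pi * |ξ|)) 2 ^ 2) * ‖F ξ‖ₑ ^ 2 *
          ENNReal.ofReal (t ^ (-1 - 2 * s)) := by
        refine lintegral_lintegral_swap ?_
        refine AEMeasurable.mul (M := ℝ≥0∞) (AEMeasurable.mul (M := ℝ≥0∞) ?_ ?_) ?_
        · exact (by fun_prop : Continuous fun p : ℝ × ℝ =>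
            min (|p.1| * (2 * Real.pi * |p.2|)) 2 ^ 2).measurable.ennreal_ofReal.aemeasurable
        · exact (hF.enorm.comp_snd).pow_const 2
        · exact (by fun_prop : Measurable fun p : ℝ × ℝ =>
            ENNReal.ofReal (p.1 ^ (-1 - 2 * s))).aemeasurable
    _ ≤ ∫⁻ ξ : ℝ, ENNReal.ofReal (1 / (2 - 2 * s) + 2 / s) *
        ‖(((2 * Real.pi * |ξ|) ^ s : ℝ) : ℂ) * F ξ‖ₑ ^ 2 := by
        refine lintegral_mono_ae ?_
        filter_upwards [(measure_eq_zero_iff_ae_notMem.1 (Real.volume_singleton (a := 0)))] with ξ hξ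
        have ha : 0 < 2 * Real.pi * |ξ| := by
          have : 0 < |ξ| := abs_pos.2 hξ
          positivity
        have h1 := lintegral_Ioi_min_sq_mul_rpow_le hs0 hs1 ha
        calc _ = ∫⁻ t in Set.Ioi (0 : ℝ), (ENNReal.ofReal (min (t * (2 * Real.pi * |ξ|)) 2 ^ 2) *
              ENNReal.ofReal (t ^ (-1 - 2 * s))) * ‖F ξ‖ₑ ^ 2 := by
              refine setLIntegral_congr_fun measurableSet_Ioi fun t ht => ?_
              rw [abs_of_pos (show 0 < t from ht)]; ring
          _ ≤ _ := by
              rw [lintegral_mul_const' _ _ (by finiteness), enorm_mul, mul_pow,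
                ← ofReal_norm (((2 * Real.pi * |ξ|) ^ s : ℝ) : ℂ), Complex.norm_real,
                Real.norm_of_nonneg (by positivity), ← ENNReal.ofReal_pow (by positivity),
                ← Real.rpow_natCast, ← Real.rpow_mul ha.le, ← mul_assoc]
              gcongr
              refine h1.trans (le_of_eq ?_)
              push_cast
              ring_nf
    _ = _ := lintegral_const_mul' _ _ ENNReal.ofReal_ne_top

/-! ### Decay of means over long intervals. -/

/-- The mean of `u` over `[x, x + ρ]`. -/
noncomputable def fwdMean (u : ℝ → ℝ) (ρ x : ℝ) : ℝ := ρ⁻¹ * ∫ y in x..x + ρ, u y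

/-- Substituting y = x + ρτ turns the mean into an integral over the fixed interval [0, 1], where
dominated convergence applies. -/
theorem tendsto_mean_of_tendsto_zero {u : ℝ → ℂ} (hc : Continuous u) {B : ℝ}
    (hB : ∀ x, ‖u x‖ ≤ B) (hu : Tendsto u atTop (𝓝 0)) (x : ℝ) :
    Tendsto (fun ρ : ℝ => (ρ⁻¹ : ℂ) * ∫ y in x..x + ρ, u y) atTop (𝓝 0) := by
  have h1 : Tendsto (fun ρ : ℝ => ∫ τ in (0 : ℝ)..1, u (x + ρ * τ)) atTop
      (𝓝 (∫ τ in (0 : ℝ)..1, (0 : ℂ))) := by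
    refine intervalIntegral.tendsto_integral_filter_of_dominated_convergence (fun _ => B)
      (.of_forall fun ρ => ?_) (.of_forall fun ρ => .of_forall fun τ _ => hB _) (by simp)
      (.of_forall fun τ hτ => ?_)
    · exact (hc.comp (by fun_prop)).aestronglyMeasurable
    · rw [Set.uIoc_of_le zero_le_one] at hτ
      exact hu.comp (tendsto_atTop_add_const_left _ _ (tendsto_id.atTop_mul_const hτ.1))
  rw [intervalIntegral.integral_zero] at h1
  refine h1.congr' ?_
  filter_upwards [eventually_gt_atTop 0] with ρ hρ
  rw [intervalIntegral.integral_comp_add_mul _ hρ.ne']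
  simp

theorem norm_intervalIntegral_le_sqrt_mul {E : Type*} [NormedAddCommGroup E] [NormedSpace ℝ E]
    {u : ℝ → E} (hu : AEStronglyMeasurable u volume) (x : ℝ) {ρ : ℝ} (hρ : 0 < ρ) :
    ‖∫ y in x..x + ρ, u y‖ₑ ^ 2 ≤ ENNReal.ofReal ρ * ∫⁻ y in Set.Ioc x (x + ρ), ‖u y‖ₑ ^ 2 := by
  rw [intervalIntegral.integral_of_le (by linarith)]
  refine (pow_le_pow_left' (enorm_integral_le_lintegral_enorm _) 2).trans ?_
  refine (lintegral_sq_le_measure_mul hu.enorm _).trans (le_of_eq ?_)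
  rw [Real.volume_Ioc]
  congr 2; ring

theorem tendsto_mean_of_memLp {E : Type*} [NormedAddCommGroup E] [NormedSpace ℝ E]
    {u : ℝ → E} (hu : MemLp u 2) (x : ℝ) :
    Tendsto (fun ρ : ℝ => ρ⁻¹ • ∫ y in x..x + ρ, u y) atTop (𝓝 0) := by
  have hfin : ∫⁻ y, ‖u y‖ₑ ^ 2 ≠ ∞ := by
    rw [← eLpNorm_two_sq]; exact ENNReal.pow_ne_top hu.2.ne
  set M := (∫⁻ y, ‖u y‖ₑ ^ 2).toReal with hM
  refine squeeze_zero_norm' (a := fun ρ => √(ρ⁻¹ * M)) ?_ ?_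
  · filter_upwards [eventually_gt_atTop 0] with ρ hρ
    refine Real.le_sqrt_of_sq_le ?_
    have h1 := (norm_intervalIntegral_le_sqrt_mul hu.1 x hρ).trans
      (mul_le_mul_right (setLIntegral_le_lintegral _ _) _)
    rw [← ENNReal.ofReal_toReal hfin, ← hM, ← ENNReal.ofReal_mul hρ.le, ← ofReal_norm,
      ← ENNReal.ofReal_pow (norm_nonneg _), ENNReal.ofReal_le_ofReal_iff (by positivity)] at h1
    rw [norm_smul, mul_pow, Real.norm_of_nonneg (by positivity)]
    calc _ ≤ ρ⁻¹ ^ 2 * (ρ * M) := by gcongr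
      _ = _ := by field_simp
  · have : Tendsto (fun ρ : ℝ => ρ⁻¹ * M) atTop (𝓝 (0 * M)) :=
      tendsto_inv_atTop_zero.mul_const M
    simpa using this.sqrt

/-- This rules out additive constants, for which Hardy's inequality fails. Cut F at |ξ| = 1. The low
part is integrable, so its inverse transform k is bounded, continuous and vanishes at infinity by
Riemann–Lebesgue. The high part is dominated by (2π|ξ|)^s F, so f - k lies in L², and its means
decay by Cauchy–Schwarz. -/
theorem tendsto_mean_of_fracLaplacian {s : ℝ} (hs0 : 0 < s) {f F : ℝ → ℂ}
    (hf : LocallyIntegrable f volume) (hF : LocallyIntegrable F volume)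
    (h : ∀ φ : 𝓢(ℝ, ℂ), Integrable (fun x => f x * (𝓕 φ : 𝓢(ℝ, ℂ)) x) ∧
      Integrable (fun ξ => F ξ * φ ξ) ∧
      ∫ x, f x * (𝓕 φ : 𝓢(ℝ, ℂ)) x = ∫ ξ, F ξ * φ ξ)
    (hG : MemLp (fun ξ => (((2 * Real.pi * |ξ|) ^ s : ℝ) : ℂ) * F ξ) 2) (x : ℝ) :
    Tendsto (fun ρ : ℝ => (ρ⁻¹ : ℂ) * ∫ y in x..x + ρ, f y) atTop (𝓝 0) := by
  set S : Set ℝ := Set.Icc (-1) 1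
  have hlow : Integrable (S.indicator F) :=
    (hF.integrableOn_isCompact isCompact_Icc).integrable_indicator measurableSet_Icc
  have hhigh : MemLp (Sᶜ.indicator F) 2 := by
    refine hG.of_le (hF.aestronglyMeasurable.indicator measurableSet_Icc.compl)
      (.of_forall fun ξ => ?_)
    by_cases hξ : ξ ∈ Sᶜ
    · rw [Set.indicator_of_mem hξ, norm_mul, Complex.norm_real]
      have h1 : 1 < |ξ| := by
        by_contra hc
        exact hξ (abs_le.1 (not_lt.1 hc))
      have h2 : 1 ≤ (2 * Real.pi * |ξ|) ^ s :=
        Real.one_le_rpow (by nlinarith [Real.pi_gt_three]) hs0.le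
      rw [Real.norm_of_nonneg (by linarith)]
      nlinarith [norm_nonneg (F ξ)]
    · rw [Set.indicator_of_notMem hξ, norm_zero]; positivity
  set k : ℝ → ℂ := 𝓕⁻ (S.indicator F)
  have hk0 : k = fun x => 𝓕 (S.indicator F) (-x) := by
    ext x; exact Real.fourierInv_eq_fourier_neg _ _
  have hkc : Continuous k := by
    rw [hk0]
    exact (VectorFourier.fourierIntegral_continuous Real.continuous_fourierChar
      continuous_inner hlow).comp continuous_neg
  have hkB : ∀ x, ‖k x‖ ≤ ∫ ξ, ‖S.indicator F ξ‖ := fun x => by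
    rw [hk0]
    exact VectorFourier.norm_fourierIntegral_le_integral_norm _ _ _ _ _
  have hkz : Tendsto k atTop (𝓝 0) := by
    rw [hk0]
    exact (Real.zero_at_infty_fourier _).comp
      ((tendsto_neg_atTop_atBot).mono_right atBot_le_cocompact)
  have hg : MemLp (fun x => f x - k x) 2 := by
    have hkloc : LocallyIntegrable k volume := hkc.locallyIntegrable
    have he := ae_eq_fourierInv_of_integral_eq (f := fun x => f x - k x)
      (hf.sub hkloc) hhigh fun φ => ?_
    · exact (memLp_congr_ae he).2 (Lp.memLp _)
    obtain ⟨a1, a2, a3⟩ := h φ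
    have hki : Integrable (fun x => k x * (𝓕 φ : 𝓢(ℝ, ℂ)) x) :=
      (𝓕 φ : 𝓢(ℝ, ℂ)).integrable.bdd_mul hkc.aestronglyMeasurable (.of_forall hkB)
    have hi1 : Integrable (fun ξ => S.indicator F ξ * φ ξ) := by
      have := a2.indicator (measurableSet_Icc : MeasurableSet S)
      refine this.congr (.of_forall fun ξ => ?_)
      dsimp only
      by_cases hξ : ξ ∈ S
      · rw [Set.indicator_of_mem hξ, Set.indicator_of_mem hξ]
      · rw [Set.indicator_of_notMem hξ, Set.indicator_of_notMem hξ, zero_mul]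
    simp only [sub_mul]
    rw [integral_sub a1 hki, a3, integral_fourierInv_mul_fourier hlow, ← integral_sub a2 hi1]
    refine integral_congr_ae (.of_forall fun ξ => ?_)
    simp only [Set.indicator_compl, Pi.sub_apply]
    ring
  have h1 := tendsto_mean_of_tendsto_zero hkc hkB hkz x
  have h2 := (tendsto_mean_of_memLp hg x).add h1
  rw [add_zero] at h2
  refine h2.congr fun ρ => ?_
  rw [intervalIntegral.integral_sub, Complex.real_smul]
  · push_cast; ring
  · exact (hf.integrableOn_isCompact isCompact_uIcc).intervalIntegrable
  · exact hkc.intervalIntegrable _ _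

theorem fracLaplacian_estimates {s : ℝ} (hs0 : 0 < s) (hs1 : s < 1) {f g : ℝ → ℝ}
    (h : MultiComm.HasFracLaplacian s f g) (hg : MemLp g 2) :
    LocallyIntegrable f volume ∧ (∀ x, Tendsto (fun ρ => fwdMean f ρ x) atTop (𝓝 0)) ∧
    ∫⁻ t in Set.Ioi (0 : ℝ), (∫⁻ x, ‖f (x + t) - f x‖ₑ ^ 2) * ENNReal.ofReal (t ^ (-1 - 2 * s)) ≤
      ENNReal.ofReal (1 / (2 - 2 * s) + 2 / s) * ∫⁻ x, ‖g x‖ₑ ^ 2 := by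
  obtain ⟨F, ⟨hf, hF, hfF⟩, ⟨hgl, hG, hgG⟩⟩ := h
  have hfc : LocallyIntegrable (fun x => (f x : ℂ)) volume := fun x => (hf x).imp fun _ hU => ⟨hU.1, hU.2.ofReal⟩
  have hgc : MemLp (fun x => (g x : ℂ)) 2 := hg.ofReal
  -- Plancherel for g identifies the L² norm of the multiplier side with that of g.
  have hn := eLpNorm_fourier_eq_of_integral_eq hgc hG fun φ => (hgG φ).2.2
  have hG2 : MemLp (fun ξ => (((2 * Real.pi * |ξ|) ^ s : ℝ) : ℂ) * F ξ) 2 :=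
    ⟨hG.aestronglyMeasurable, hn ▸ hgc.2⟩
  refine ⟨hf, fun x => ?_, ?_⟩
  · have := tendsto_mean_of_fracLaplacian hs0 hfc hF hfF hG2 x
    have h2 := (Complex.continuous_re.tendsto 0).comp this
    refine h2.congr fun ρ => ?_
    simp only [Function.comp_apply, intervalIntegral.integral_ofReal, fwdMean]
    rw [← Complex.ofReal_inv, ← Complex.ofReal_mul, Complex.ofReal_re]
  · have := lintegral_translate_sub_sq_le hs0 hs1 hfc hF.aestronglyMeasurable hfF hG2
    rw [← eLpNorm_two_sq, hn, eLpNorm_two_sq] at this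
    have hr : ∀ r : ℝ, ‖(r : ℂ)‖ₑ = ‖r‖ₑ := fun r => by simp [enorm]
    simpa only [← Complex.ofReal_sub, hr] using this

/-! ### Fractional Hardy inequality with rearranged weights. -/

theorem setLIntegral_Ioc_add (g : ℝ → ℝ≥0∞) (x ρ : ℝ) :
    ∫⁻ y in Set.Ioc x (x + ρ), g y = ∫⁻ t in Set.Ioc 0 ρ, g (x + t) := by
  rw [← lintegral_indicator measurableSet_Ioc, ← lintegral_indicator measurableSet_Ioc,
    ← lintegral_add_left_eq_self _ x]
  refine lintegral_congr fun t => ?_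
  by_cases h : t ∈ Set.Ioc 0 ρ
  · rw [Set.indicator_of_mem h, Set.indicator_of_mem]
    exact ⟨by linarith [h.1], by linarith [h.2]⟩
  · rw [Set.indicator_of_notMem h, Set.indicator_of_notMem]
    exact fun h' => h ⟨by linarith [h'.1], by linarith [h'.2]⟩

theorem MeasureTheory.LocallyIntegrable.intervalIntegrable' {u : ℝ → ℝ}
    (hu : LocallyIntegrable u volume) (a b : ℝ) : IntervalIntegrable u volume a b :=
  (hu.integrableOn_isCompact isCompact_uIcc).intervalIntegrable

theorem enorm_sub_fwdMean_sq_le {u : ℝ → ℝ} (hu : LocallyIntegrable u volume) {ρ : ℝ} (hρ : 0 < ρ)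
    (x : ℝ) : ‖u x - fwdMean u ρ x‖ₑ ^ 2 ≤
      ENNReal.ofReal ρ⁻¹ * ∫⁻ t in Set.Ioc 0 ρ, ‖u (x + t) - u x‖ₑ ^ 2 := by
  have e : u x - fwdMean u ρ x = -(ρ⁻¹ * ∫ y in x..x + ρ, (u y - u x)) := by
    rw [intervalIntegral.integral_sub (hu.intervalIntegrable' _ _) (by simp), fwdMean]
    simp
    field_simp
    ring
  rw [e, enorm_neg, enorm_mul, mul_pow]
  refine (mul_le_mul_right (norm_intervalIntegral_le_sqrt_mul
    (hu.aestronglyMeasurable.sub aestronglyMeasurable_const) x hρ) _).trans (le_of_eq ?_)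
  rw [setLIntegral_Ioc_add, ← mul_assoc, Real.enorm_eq_ofReal (by positivity),
    ← ENNReal.ofReal_pow (by positivity), ← ENNReal.ofReal_mul (by positivity)]
  congr 2
  field_simp

/-- The near part of Hardy's inequality. On (0, ρ] one has t ≤ 2a, so the constant a^{-2s}ρ^{-1} is
at most 2^{1+2s} t^{-1-2s}. -/
theorem rpow_mul_enorm_sub_fwdMean_sq_le {s : ℝ} (hs : 0 < s) {u : ℝ → ℝ}
    (hu : LocallyIntegrable u volume) {a ρ : ℝ} (ha : 0 < a) (h1 : a ≤ ρ) (h2 : ρ ≤ 2 * a) (x : ℝ) :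
    ENNReal.ofReal (a ^ (-(2 * s))) * ‖u x - fwdMean u ρ x‖ₑ ^ 2 ≤
      ENNReal.ofReal (2 ^ (1 + 2 * s)) *
        ∫⁻ t in Set.Ioi 0, ‖u (x + t) - u x‖ₑ ^ 2 * ENNReal.ofReal (t ^ (-1 - 2 * s)) := by
  have hρ : 0 < ρ := ha.trans_le h1
  calc _ ≤ ENNReal.ofReal (a ^ (-(2 * s))) * (ENNReal.ofReal ρ⁻¹ *
        ∫⁻ t in Set.Ioc 0 ρ, ‖u (x + t) - u x‖ₑ ^ 2) := by
        gcongr; exact enorm_sub_fwdMean_sq_le hu hρ x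
    _ = ∫⁻ t in Set.Ioc 0 ρ, ENNReal.ofReal (a ^ (-(2 * s)) * ρ⁻¹) * ‖u (x + t) - u x‖ₑ ^ 2 := by
        rw [lintegral_const_mul' _ _ ENNReal.ofReal_ne_top, ENNReal.ofReal_mul (by positivity),
          mul_assoc]
    _ ≤ ∫⁻ t in Set.Ioc 0 ρ, ENNReal.ofReal (2 ^ (1 + 2 * s)) *
        (‖u (x + t) - u x‖ₑ ^ 2 * ENNReal.ofReal (t ^ (-1 - 2 * s))) := by
        refine setLIntegral_mono' measurableSet_Ioc fun t ht => ?_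
        rw [mul_comm (‖u (x + t) - u x‖ₑ ^ 2), ← mul_assoc, ← ENNReal.ofReal_mul (by positivity)]
        refine mul_le_mul_left (ENNReal.ofReal_le_ofReal ?_) _
        calc a ^ (-(2 * s)) * ρ⁻¹ ≤ a ^ (-(2 * s)) * a⁻¹ := by gcongr
          _ = 2 ^ (1 + 2 * s) * (2 * a) ^ (-1 - 2 * s) := by
            rw [Real.mul_rpow (by norm_num) ha.le, ← mul_assoc, ← Real.rpow_add (by norm_num),
              ← Real.rpow_neg_one a, ← Real.rpow_add ha]
            ring_nf; simp
          _ ≤ 2 ^ (1 + 2 * s) * t ^ (-1 - 2 * s) := by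
            refine mul_le_mul_of_nonneg_left ?_ (by positivity)
            exact Real.rpow_le_rpow_of_nonpos ht.1 (ht.2.trans h2) (by linarith)
    _ ≤ _ := by
        rw [lintegral_const_mul' _ _ ENNReal.ofReal_ne_top]
        gcongr
        exact Set.Ioc_subset_Ioi_self

/-- Halving [x, x + 2ρ] writes the difference as minus half the mean of u(y + ρ) - u(y) over [x, x +
ρ]; Cauchy–Schwarz follows. The point is that the bound is free of x. -/
theorem enorm_fwdMean_sub_fwdMean_sq_le {u : ℝ → ℝ} (hu : LocallyIntegrable u volume) {ρ : ℝ}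
    (hρ : 0 < ρ) (x : ℝ) : ‖fwdMean u ρ x - fwdMean u (2 * ρ) x‖ₑ ^ 2 ≤
      ENNReal.ofReal ρ⁻¹ * ∫⁻ y, ‖u (y + ρ) - u y‖ₑ ^ 2 := by
  have hi := hu.intervalIntegrable'
  have hit : IntervalIntegrable (fun y => u (y + ρ)) volume x (x + ρ) := by
    have := (hi (x + ρ) (x + ρ + ρ)).comp_add_right ρ
    simpa using this
  have e : fwdMean u ρ x - fwdMean u (2 * ρ) x =
      -((2 * ρ)⁻¹ * ∫ y in x..x + ρ, (u (y + ρ) - u y)) := by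
    rw [intervalIntegral.integral_sub hit (hi _ _), intervalIntegral.integral_comp_add_right,
      fwdMean, fwdMean, ← intervalIntegral.integral_add_adjacent_intervals (hi x (x + ρ))
        (hi (x + ρ) (x + 2 * ρ)), show x + ρ + ρ = x + 2 * ρ by ring]
    field_simp
    ring
  rw [e, enorm_neg, enorm_mul, mul_pow]
  have hm : AEStronglyMeasurable (fun y => u (y + ρ) - u y) volume :=
    (hu.aestronglyMeasurable.comp_measurePreserving
      (measurePreserving_add_right volume ρ)).sub hu.aestronglyMeasurable
  refine (mul_le_mul_right ((norm_intervalIntegral_le_sqrt_mul hm x hρ).trans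
    (mul_le_mul_right (setLIntegral_le_lintegral _ _) _)) _).trans ?_
  rw [← mul_assoc, Real.enorm_eq_ofReal (by positivity),
    ← ENNReal.ofReal_pow (by positivity), ← ENNReal.ofReal_mul (by positivity)]
  gcongr
  rw [mul_inv, mul_pow, mul_assoc]
  have : ρ⁻¹ ^ 2 * ρ = ρ⁻¹ := by field_simp
  rw [this]
  have : 0 < ρ⁻¹ := by positivity
  linarith

/-- Telescoping over the scales 2^n ρ; the decay of the means removes the boundary term at infinity.
-/
theorem enorm_le_add_tsum {u : ℝ → ℝ} {x ρ : ℝ} (hρ : 0 < ρ)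
    (h : Tendsto (fun ρ => fwdMean u ρ x) atTop (𝓝 0)) :
    ‖u x‖ₑ ≤ ‖u x - fwdMean u ρ x‖ₑ +
      ∑' n : ℕ, ‖fwdMean u (2 ^ n * ρ) x - fwdMean u (2 * (2 ^ n * ρ)) x‖ₑ := by
  have h1 : Tendsto (fun n : ℕ => fwdMean u (2 ^ n * ρ) x) atTop (𝓝 0) :=
    h.comp ((tendsto_pow_atTop_atTop_of_one_lt one_lt_two).atTop_mul_const hρ)
  have h2 := edist_le_tsum_of_edist_le_of_tendsto₀
    (fun n => ‖fwdMean u (2 ^ n * ρ) x - fwdMean u (2 * (2 ^ n * ρ)) x‖ₑ) (fun n => ?_) h1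
  · rw [pow_zero, one_mul, edist_zero_right] at h2
    calc ‖u x‖ₑ = ‖(u x - fwdMean u ρ x) + fwdMean u ρ x‖ₑ := by rw [sub_add_cancel]
      _ ≤ _ := (enorm_add_le _ _).trans (by gcongr)
  · rw [edist_eq_enorm_sub, pow_succ, mul_comm (2 ^ n) 2, mul_assoc]

theorem ENNReal.tsum_mul_sq_le (f g : ℕ → ℝ≥0∞) :
    (∑' n, f n * g n) ^ 2 ≤ (∑' n, f n ^ 2) * ∑' n, g n ^ 2 := by
  simpa [lintegral_count] using lintegral_mul_sq_le (μ := Measure.count) (f := f) (g := g)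
    (measurable_of_countable _).aemeasurable (measurable_of_countable _).aemeasurable

theorem ENNReal.ofReal_two_rpow (y : ℝ) : ENNReal.ofReal ((2 : ℝ) ^ y) = (2 : ℝ≥0∞) ^ y := by
  rw [← ENNReal.ofReal_rpow_of_pos two_pos]; simp

theorem ENNReal.two_rpow_add (y z : ℝ) : (2 : ℝ≥0∞) ^ (y + z) = 2 ^ y * 2 ^ z :=
  ENNReal.rpow_add y z two_ne_zero ENNReal.ofNat_ne_top

theorem setLIntegral_Ioc_comp_mul_left (g : ℝ → ℝ≥0∞) {c : ℝ} (hc : 0 < c) (a b : ℝ)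
    (hg : Measurable g) :
    ∫⁻ t in Set.Ioc a b, g (c * t) = ENNReal.ofReal c⁻¹ * ∫⁻ t in Set.Ioc (c * a) (c * b), g t := by
  have h := Real.map_volume_mul_left hc.ne'
  rw [abs_of_pos (inv_pos.2 hc)] at h
  rw [← smul_eq_mul, ← lintegral_smul_measure, ← Measure.restrict_smul, ← h,
    setLIntegral_map measurableSet_Ioc hg (measurable_const_mul c)]
  congr 2
  ext t
  simp [hc, mul_div_cancel_left₀ _ hc.ne']

theorem ofReal_two_zpow_inv (j : ℤ) : ENNReal.ofReal ((2 : ℝ) ^ j)⁻¹ = (2 : ℝ≥0∞) ^ (-(j : ℝ)) := by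
  rw [← ENNReal.ofReal_two_rpow, Real.rpow_neg zero_le_two, Real.rpow_intCast]

/-- The dyadic pieces of `∫ B(t) t^{-1-2s} dt`. -/
noncomputable def dyadicPiece (s : ℝ) (B : ℝ → ℝ≥0∞) (l : ℝ) (j : ℤ) : ℝ≥0∞ :=
  2 ^ (-(2 * s * j)) * B (2 ^ j * l)

/-- The far part. The squared increments gain 2^{-(1-2s)n} relative to the dyadic pieces. Half of
this gain pays for Cauchy–Schwarz in n, the other half remains as a convolution weight. The factor
2^{-i} is kept to cancel the measure of {r ~ 2^i}. -/
theorem tsum_enorm_fwdMean_sq_le {s : ℝ} {u : ℝ → ℝ} (hu : LocallyIntegrable u volume)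
    {l : ℝ} (hl : 1 ≤ l) (i : ℤ) (x : ℝ) :
    (2 : ℝ≥0∞) ^ (-(2 * s * i)) * (∑' n : ℕ, ‖fwdMean u (2 ^ n * (2 ^ i * l)) x -
        fwdMean u (2 * (2 ^ n * (2 ^ i * l))) x‖ₑ) ^ 2 ≤
      (∑' n : ℕ, (2 : ℝ≥0∞) ^ (-(n * ((1 - 2 * s) / 2)))) * 2 ^ (-(i : ℝ)) *
        ∑' n : ℕ, 2 ^ (-(n * ((1 - 2 * s) / 2))) *
          dyadicPiece s (fun t => ∫⁻ y, ‖u (y + t) - u y‖ₑ ^ 2) l (i + n) := by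
  set κ := (1 - 2 * s) / 2 with hκ
  set B : ℝ → ℝ≥0∞ := fun t => ∫⁻ y, ‖u (y + t) - u y‖ₑ ^ 2 with hB
  set c : ℕ → ℝ≥0∞ := fun n => ‖fwdMean u (2 ^ n * (2 ^ i * l)) x -
        fwdMean u (2 * (2 ^ n * (2 ^ i * l))) x‖ₑ with hc
  have hl0 : 0 < l := by linarith
  have hcn : ∀ n : ℕ, c n ^ 2 ≤ 2 ^ (-((i : ℝ) + n)) * B (2 ^ (i + n : ℤ) * l) := fun n => by
    have e : (2 : ℝ) ^ n * (2 ^ i * l) = 2 ^ (i + n : ℤ) * l := by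
      rw [zpow_add₀ two_ne_zero, zpow_natCast]; ring
    have h1 := enorm_fwdMean_sub_fwdMean_sq_le hu (ρ := 2 ^ n * (2 ^ i * l)) (by positivity) x
    refine h1.trans ?_
    rw [e]
    refine mul_le_mul_left ?_ _
    have := ofReal_two_zpow_inv (i + n)
    push_cast at this
    rw [← this]
    refine ENNReal.ofReal_le_ofReal (inv_anti₀ (by positivity) ?_)
    exact le_mul_of_one_le_right (by positivity) hl
  have h1 : (∑' n, c n) ^ 2 ≤ (∑' n : ℕ, (2 : ℝ≥0∞) ^ (-(n * κ))) * ∑' n : ℕ, 2 ^ (n * κ) * c n ^ 2 := by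
    have := ENNReal.tsum_mul_sq_le (fun n : ℕ => (2 : ℝ≥0∞) ^ (-(n * κ / 2)))
      (fun n => 2 ^ (n * κ / 2) * c n)
    have e1 : ∀ n : ℕ, (2 : ℝ≥0∞) ^ (-(n * κ / 2)) * (2 ^ (n * κ / 2) * c n) = c n := fun n => by
      rw [← mul_assoc, ← ENNReal.two_rpow_add]; simp
    have e2 : ∀ y : ℝ, ((2 : ℝ≥0∞) ^ (y / 2)) ^ 2 = 2 ^ y := fun y => by
      rw [sq, ← ENNReal.two_rpow_add]; simp
    have e3 : ∀ n : ℕ, ((2 : ℝ≥0∞) ^ (-(n * κ / 2))) ^ 2 = 2 ^ (-(n * κ)) := fun n => by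
      rw [← neg_div, e2]
    simpa only [e1, mul_pow, e2, e3] using this
  calc _ ≤ (2 : ℝ≥0∞) ^ (-(2 * s * i)) * ((∑' n : ℕ, (2 : ℝ≥0∞) ^ (-(n * κ))) *
        ∑' n : ℕ, 2 ^ (n * κ) * (2 ^ (-((i : ℝ) + n)) * B (2 ^ (i + n : ℤ) * l))) := by
        refine mul_le_mul_right (h1.trans (mul_le_mul_right (ENNReal.tsum_le_tsum fun n => ?_) _)) _
        exact mul_le_mul_right (hcn n) _
    _ = (∑' n : ℕ, (2 : ℝ≥0∞) ^ (-(n * κ))) * ∑' n : ℕ, 2 ^ (-(2 * s * i)) * 2 ^ (n * κ) *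
          2 ^ (-((i : ℝ) + n)) * B (2 ^ (i + n : ℤ) * l) := by
        rw [← mul_assoc, mul_comm ((2 : ℝ≥0∞) ^ (-(2 * s * i))), mul_assoc, ← ENNReal.tsum_mul_left]
        simp only [mul_assoc]
    _ = _ := by
        rw [mul_assoc _ ((2 : ℝ≥0∞) ^ (-(i : ℝ))), ← ENNReal.tsum_mul_left (a := 2 ^ (-(i : ℝ)))]
        congr 1
        refine tsum_congr fun n => ?_
        rw [dyadicPiece, ← mul_assoc, ← mul_assoc]
        simp only [← ENNReal.two_rpow_add]
        congr 2
        push_cast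
        rw [hκ]
        ring

theorem tsum_tsum_shift (q : ℕ → ℝ≥0∞) (a : ℤ → ℝ≥0∞) :
    ∑' i : ℤ, ∑' n : ℕ, q n * a (i + n) = (∑' n, q n) * ∑' j, a j := by
  rw [ENNReal.tsum_comm, ← ENNReal.tsum_mul_right]
  refine tsum_congr fun n => ?_
  rw [ENNReal.tsum_mul_left]
  congr 1
  exact (Equiv.addRight (n : ℤ)).tsum_eq a

/-- The maps l ↦ 2^j l carry (1, 2] onto intervals tiling (0, ∞). Averaging over l thus recovers the
full integral without any monotonicity of B; the constant compares t^{-1-2s} with its value at the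
right endpoint. -/
theorem lintegral_tsum_dyadicPiece_le {s : ℝ} (hs : 0 < s) {B : ℝ → ℝ≥0∞} (hB : Measurable B) :
    ∫⁻ l in Set.Ioc (1 : ℝ) 2, ∑' j, dyadicPiece s B l j ≤
      ENNReal.ofReal (2 ^ (1 + 2 * s)) *
        ∫⁻ t in Set.Ioi (0 : ℝ), B t * ENNReal.ofReal (t ^ (-1 - 2 * s)) := by
  rw [lintegral_tsum (fun j => by unfold dyadicPiece; fun_prop)]
  have h1 : ∀ j : ℤ, ∫⁻ l in Set.Ioc (1 : ℝ) 2, dyadicPiece s B l j ≤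
      ∫⁻ t in Set.Ioc ((2 : ℝ) ^ j) (2 ^ (j + 1)), ENNReal.ofReal (2 ^ (1 + 2 * s)) *
        (B t * ENNReal.ofReal (t ^ (-1 - 2 * s))) := fun j => by
    have hp : (0 : ℝ) < 2 ^ j := by positivity
    unfold dyadicPiece
    rw [lintegral_const_mul _ (by fun_prop), setLIntegral_Ioc_comp_mul_left B hp _ _ hB,
      ← mul_assoc, mul_one, ← zpow_add_one₀ two_ne_zero, ofReal_two_zpow_inv,
      ← ENNReal.two_rpow_add, ← lintegral_const_mul _ hB]
    refine setLIntegral_mono' measurableSet_Ioc fun t ht => ?_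
    have ht0 : 0 < t := hp.trans ht.1
    rw [mul_comm (B t), ← mul_assoc, ← ENNReal.ofReal_mul (by positivity),
      ← ENNReal.ofReal_two_rpow]
    refine mul_le_mul_left (ENNReal.ofReal_le_ofReal ?_) _
    have h2 : ((2 : ℝ) ^ (j + 1)) ^ (-1 - 2 * s) ≤ t ^ (-1 - 2 * s) :=
      Real.rpow_le_rpow_of_nonpos ht0 ht.2 (by linarith)
    refine le_trans (le_of_eq ?_) (mul_le_mul_of_nonneg_left h2 (by positivity))
    rw [← Real.rpow_intCast, ← Real.rpow_mul (by norm_num), ← Real.rpow_add (by norm_num)]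
    congr 1
    push_cast
    ring
  have hd : Pairwise (Function.onFun Disjoint fun j : ℤ => Set.Ioc ((2 : ℝ) ^ j) (2 ^ (j + 1))) :=
    (zpow_right_mono₀ one_le_two).pairwise_disjoint_on_Ioc_succ
  refine (ENNReal.tsum_le_tsum h1).trans ?_
  rw [← lintegral_iUnion (fun j => measurableSet_Ioc) hd,
    lintegral_const_mul _ (by fun_prop)]
  gcongr
  exact Set.iUnion_subset fun j t ht => (show (0 : ℝ) < 2 ^ j by positivity).trans ht.1

theorem ENNReal.add_sq_le_four_mul (a b : ℝ≥0∞) : (a + b) ^ 2 ≤ 4 * (a ^ 2 + b ^ 2) := by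
  wlog h : a ≤ b
  · rw [add_comm a, add_comm (a ^ 2)]
    exact this b a (le_of_not_ge h)
  calc (a + b) ^ 2 ≤ (2 * b) ^ 2 := by
        refine pow_le_pow_left' ?_ 2
        rw [two_mul]; gcongr
    _ = 4 * b ^ 2 := by rw [mul_pow]; norm_num
    _ ≤ _ := by gcongr; exact le_add_self

theorem tsum_two_rpow_neg_ne_top {κ : ℝ} (hκ : 0 < κ) :
    ∑' n : ℕ, (2 : ℝ≥0∞) ^ (-(n * κ)) ≠ ∞ := by
  have h : ∀ n : ℕ, (2 : ℝ≥0∞) ^ (-(n * κ)) = (2 ^ (-κ)) ^ n := fun n => by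
    rw [← ENNReal.rpow_natCast, ← ENNReal.rpow_mul]; congr 1; ring
  simp only [h, ENNReal.tsum_geometric]
  rw [ENNReal.inv_ne_top, ← pos_iff_ne_zero, tsub_pos_iff_lt]
  exact ENNReal.rpow_lt_one_of_one_lt_of_neg ENNReal.one_lt_two (by linarith)

/-- Pointwise form of the weighted fractional Hardy inequality. -/
theorem inv_rpow_mul_enorm_sq_le {s : ℝ} (hs : 0 < s) {r : ℝ → ℝ≥0∞} {u : ℝ → ℝ}
    (hu : LocallyIntegrable u volume) {x : ℝ} (hx : Tendsto (fun ρ => fwdMean u ρ x) atTop (𝓝 0))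
    {l : ℝ} (hl1 : 1 ≤ l) (hl2 : l ≤ 2) (hr0 : r x ≠ 0) :
    (r x)⁻¹ ^ (2 * s) * ‖u x‖ₑ ^ 2 ≤
      4 * ENNReal.ofReal (2 ^ (1 + 2 * s)) *
        (∫⁻ t in Set.Ioi 0, ‖u (x + t) - u x‖ₑ ^ 2 * ENNReal.ofReal (t ^ (-1 - 2 * s))) +
      ∑' i : ℤ, {y | (2 : ℝ≥0∞) ^ (i : ℝ) ≤ r y ∧ r y < 2 ^ ((i : ℝ) + 1)}.indicator (fun _ =>
        4 * ((∑' n : ℕ, (2 : ℝ≥0∞) ^ (-(n * ((1 - 2 * s) / 2)))) * 2 ^ (-(i : ℝ)) *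
        ∑' n : ℕ, 2 ^ (-(n * ((1 - 2 * s) / 2))) *
          dyadicPiece s (fun t => ∫⁻ y, ‖u (y + t) - u y‖ₑ ^ 2) l (i + n))) x := by
  by_cases hrt : r x = ∞
  · simp [hrt, hs]
  -- The scale i is fixed by 2^i ≤ r(x) < 2^{i+1}, and the telescoping starts at ρ = 2^i l.
  obtain ⟨i, hi⟩ := ENNReal.exists_mem_Ico_zpow hr0 hrt (y := 2) ENNReal.one_lt_two ENNReal.ofNat_ne_top
  have hmem : x ∈ {y | (2 : ℝ≥0∞) ^ (i : ℝ) ≤ r y ∧ r y < 2 ^ ((i : ℝ) + 1)} := by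
    have h2 := hi.2
    rw [← ENNReal.rpow_intCast] at h2
    push_cast at h2
    exact ⟨by rw [ENNReal.rpow_intCast]; exact hi.1, h2⟩
  have hw : (r x)⁻¹ ^ (2 * s) ≤ 2 ^ (-(2 * s * i)) := by
    calc (r x)⁻¹ ^ (2 * s) ≤ ((2 : ℝ≥0∞) ^ (i : ℝ))⁻¹ ^ (2 * s) :=
          ENNReal.rpow_le_rpow (ENNReal.inv_le_inv.2 hmem.1) (by linarith)
      _ = _ := by
          rw [← ENNReal.rpow_neg, ← ENNReal.rpow_mul]; congr 1; ring
  have hp : (0 : ℝ) < 2 ^ i := by positivity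
  have hnear := rpow_mul_enorm_sub_fwdMean_sq_le hs hu (a := 2 ^ i) (ρ := 2 ^ i * l) hp
    (le_mul_of_one_le_right hp.le hl1) (by rw [mul_comm]; gcongr) x
  have ea : ENNReal.ofReal (((2 : ℝ) ^ i) ^ (-(2 * s))) = 2 ^ (-(2 * s * i)) := by
    rw [← ENNReal.ofReal_two_rpow, ← Real.rpow_intCast, ← Real.rpow_mul zero_le_two]
    congr 2; ring
  rw [ea] at hnear
  have hfar := tsum_enorm_fwdMean_sq_le (s := s) hu hl1 i x
  have hsum := enorm_le_add_tsum (u := u) (x := x) (ρ := 2 ^ i * l) (by positivity) hx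
  calc _ ≤ (2 : ℝ≥0∞) ^ (-(2 * s * i)) * (4 * (‖u x - fwdMean u (2 ^ i * l) x‖ₑ ^ 2 +
        (∑' n : ℕ, ‖fwdMean u (2 ^ n * (2 ^ i * l)) x -
          fwdMean u (2 * (2 ^ n * (2 ^ i * l))) x‖ₑ) ^ 2)) := by
        gcongr
        exact (pow_le_pow_left' hsum 2).trans (ENNReal.add_sq_le_four_mul _ _)
    _ = 4 * ((2 : ℝ≥0∞) ^ (-(2 * s * i)) * ‖u x - fwdMean u (2 ^ i * l) x‖ₑ ^ 2) +
        4 * ((2 : ℝ≥0∞) ^ (-(2 * s * i)) * (∑' n : ℕ, ‖fwdMean u (2 ^ n * (2 ^ i * l)) x -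
          fwdMean u (2 * (2 ^ n * (2 ^ i * l))) x‖ₑ) ^ 2) := by ring
    _ ≤ _ := by
        refine add_le_add ?_ ?_
        · rw [mul_assoc 4]; exact mul_le_mul_right hnear _
        · refine le_trans ?_ (ENNReal.le_tsum i)
          rw [Set.indicator_of_mem hmem]
          gcongr

/-- In the integrated pointwise bound, the far term is constant on {2^i ≤ r < 2^{i+1}}, whose
measure is at most 2^{i+1}; this cancels 2^{-i}. What remains is an ℓ¹ convolution in (i, n),
followed by an average over l. -/
theorem weighted_hardy_of_measurable {s : ℝ} (hs0 : 0 < s) {r : ℝ → ℝ≥0∞}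
    (hr : Measurable r) (hrd : ∀ a : ℝ≥0∞, volume {x | r x ≤ a} ≤ a) {u : ℝ → ℝ}
    (hum : Measurable u) (hu : LocallyIntegrable u volume)
    (hx : ∀ x, Tendsto (fun ρ => fwdMean u ρ x) atTop (𝓝 0)) :
    ∫⁻ x, (r x)⁻¹ ^ (2 * s) * ‖u x‖ₑ ^ 2 ≤
      ENNReal.ofReal (2 ^ (1 + 2 * s)) *
        (4 + 8 * (∑' n : ℕ, (2 : ℝ≥0∞) ^ (-(n * ((1 - 2 * s) / 2)))) ^ 2) *
      ∫⁻ t in Set.Ioi (0 : ℝ), (∫⁻ x, ‖u (x + t) - u x‖ₑ ^ 2) * ENNReal.ofReal (t ^ (-1 - 2 * s)) := by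
  set B : ℝ → ℝ≥0∞ := fun t => ∫⁻ y, ‖u (y + t) - u y‖ₑ ^ 2 with hBdef
  set Q := ∑' n : ℕ, (2 : ℝ≥0∞) ^ (-(n * ((1 - 2 * s) / 2))) with hQ
  set N := ∫⁻ t in Set.Ioi (0 : ℝ), B t * ENNReal.ofReal (t ^ (-1 - 2 * s)) with hN
  have hB : Measurable B := by
    have : Measurable fun p : ℝ × ℝ => ‖u (p.2 + p.1) - u p.2‖ₑ ^ 2 := by fun_prop
    exact this.lintegral_prod_right'
  have hD : ∫⁻ x, ∫⁻ t in Set.Ioi (0 : ℝ), ‖u (x + t) - u x‖ₑ ^ 2 * ENNReal.ofReal (t ^ (-1 - 2 * s)) = N := by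
    rw [lintegral_lintegral_swap (Measurable.aemeasurable (by fun_prop))]
    refine lintegral_congr fun t => ?_
    rw [lintegral_mul_const' _ _ ENNReal.ofReal_ne_top]
  have hr0 : ∀ᵐ x, r x ≠ 0 := by
    have h := hrd 0
    simp only [nonpos_iff_eq_zero] at h
    exact measure_eq_zero_iff_ae_notMem.1 h
  have hW : ∀ i : ℤ, MeasurableSet {y | (2 : ℝ≥0∞) ^ (i : ℝ) ≤ r y ∧ r y < 2 ^ ((i : ℝ) + 1)} :=
    fun i => (measurableSet_le measurable_const hr).inter (measurableSet_lt hr measurable_const)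
  have hl : ∀ l ∈ Set.Ioc (1 : ℝ) 2, ∫⁻ x, (r x)⁻¹ ^ (2 * s) * ‖u x‖ₑ ^ 2 ≤
      4 * ENNReal.ofReal (2 ^ (1 + 2 * s)) * N + 8 * Q ^ 2 * ∑' j, dyadicPiece s B l j := by
    intro l hl
    refine (lintegral_mono_ae (hr0.mono fun x h0 =>
      inv_rpow_mul_enorm_sq_le hs0 hu (hx x) hl.1.le hl.2 h0)).trans ?_
    rw [lintegral_add_right _ (Measurable.tsum fun i => measurable_const.indicator (hW i)),
      lintegral_const_mul' _ _ (by finiteness), hD,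
      lintegral_tsum fun i => (measurable_const.indicator (hW i)).aemeasurable]
    refine add_le_add_right ?_ _
    calc _ ≤ ∑' i : ℤ, 8 * Q * ∑' n : ℕ, 2 ^ (-(n * ((1 - 2 * s) / 2))) * dyadicPiece s B l (i + n) := by
          refine ENNReal.tsum_le_tsum fun i => ?_
          rw [lintegral_indicator_const (hW i)]
          have hm : volume {y | (2 : ℝ≥0∞) ^ (i : ℝ) ≤ r y ∧ r y < 2 ^ ((i : ℝ) + 1)} ≤ 2 ^ ((i : ℝ) + 1) :=
            (measure_mono fun y hy => hy.2.le).trans (hrd _)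
          refine (mul_le_mul_right hm _).trans (le_of_eq ?_)
          have e : (2 : ℝ≥0∞) ^ (-(i : ℝ)) * 2 ^ ((i : ℝ) + 1) = 2 := by
            rw [← ENNReal.two_rpow_add]; simp
          calc _ = 4 * Q * ((2 : ℝ≥0∞) ^ (-(i : ℝ)) * 2 ^ ((i : ℝ) + 1)) *
                ∑' n : ℕ, 2 ^ (-(n * ((1 - 2 * s) / 2))) * dyadicPiece s B l (i + n) := by ring
            _ = _ := by rw [e]; ring
      _ = _ := by
          rw [ENNReal.tsum_mul_left, tsum_tsum_shift]
          ring
  -- The left side does not depend on l, and (1, 2] has length one.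
  have havg : ∫⁻ x, (r x)⁻¹ ^ (2 * s) * ‖u x‖ₑ ^ 2 =
      ∫⁻ l in Set.Ioc (1 : ℝ) 2, ∫⁻ x, (r x)⁻¹ ^ (2 * s) * ‖u x‖ₑ ^ 2 := by
    rw [setLIntegral_const, Real.volume_Ioc]; norm_num
  rw [havg]
  refine (setLIntegral_mono' measurableSet_Ioc hl).trans ?_
  rw [lintegral_add_left measurable_const, setLIntegral_const, Real.volume_Ioc,
    lintegral_const_mul _ (Measurable.tsum fun j => by unfold dyadicPiece; fun_prop)]
  refine (add_le_add_right (mul_le_mul_right (lintegral_tsum_dyadicPiece_le hs0 hB) _) _).trans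
    (le_of_eq ?_)
  norm_num
  ring

/-- The condition s < 1/2 makes the geometric sum finite. Replacing u by a measurable representative
changes neither the means nor the integrals. -/
theorem weighted_hardy {s : ℝ} (hs0 : 0 < s) (hs1 : s < 1 / 2) :
    ∃ C : ℝ≥0, ∀ r : ℝ → ℝ≥0∞, Measurable r → (∀ a : ℝ≥0∞, volume {x | r x ≤ a} ≤ a) →
      ∀ u : ℝ → ℝ, LocallyIntegrable u volume →
      (∀ x, Tendsto (fun ρ => fwdMean u ρ x) atTop (𝓝 0)) →
      ∫⁻ x, (r x)⁻¹ ^ (2 * s) * ‖u x‖ₑ ^ 2 ≤ C * ∫⁻ t in Set.Ioi (0 : ℝ),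
        (∫⁻ x, ‖u (x + t) - u x‖ₑ ^ 2) * ENNReal.ofReal (t ^ (-1 - 2 * s)) := by
  have hQ := tsum_two_rpow_neg_ne_top (κ := (1 - 2 * s) / 2) (by linarith)
  refine ⟨(ENNReal.ofReal (2 ^ (1 + 2 * s)) *
    (4 + 8 * (∑' n : ℕ, (2 : ℝ≥0∞) ^ (-(n * ((1 - 2 * s) / 2)))) ^ 2)).toNNReal, ?_⟩
  intro r hr hrd u hu hx
  rw [ENNReal.coe_toNNReal (by finiteness)]
  have hae := hu.aestronglyMeasurable.ae_eq_mk
  set v := hu.aestronglyMeasurable.mk u with hv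
  have hvm : Measurable v := hu.aestronglyMeasurable.stronglyMeasurable_mk.measurable
  have hvl : LocallyIntegrable v volume := fun x =>
    (hu x).imp fun U hU => ⟨hU.1, hU.2.congr (ae_restrict_of_ae hae)⟩
  have hmean : ∀ ρ x, fwdMean v ρ x = fwdMean u ρ x := fun ρ x => by
    unfold fwdMean
    rw [intervalIntegral.integral_congr_ae (hae.mono fun y hy _ => hy.symm)]
  have h := weighted_hardy_of_measurable hs0 hr hrd hvm hvl
    (fun x => by simpa only [hmean] using hx x)
  have e1 : ∫⁻ x, (r x)⁻¹ ^ (2 * s) * ‖v x‖ₑ ^ 2 = ∫⁻ x, (r x)⁻¹ ^ (2 * s) * ‖u x‖ₑ ^ 2 :=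
    lintegral_congr_ae (hae.mono fun y hy => by simp only [hy])
  have e2 : ∀ t, ∫⁻ x, ‖v (x + t) - v x‖ₑ ^ 2 = ∫⁻ x, ‖u (x + t) - u x‖ₑ ^ 2 := fun t => by
    have ht := (measurePreserving_add_right volume t).quasiMeasurePreserving.ae hae
    refine lintegral_congr_ae ?_
    filter_upwards [hae, ht] with y h1 h2
    rw [h1, h2]
  simpa only [e1, e2] using h

/-! ### Duality for L^{2,1} with admissible weights. -/

theorem rearrangement_le_lintegral {E : Type*} [NormedAddCommGroup E] (f : ℝ → E) (t : ℝ) :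
    MultiComm.rearrangement f t ≤ ∫⁻ l in Set.Ioi (0 : ℝ),
      {l : ℝ | ENNReal.ofReal t < volume {x | ENNReal.ofReal l < ‖f x‖ₑ}}.indicator 1 l := by
  refine ENNReal.le_of_forall_nnreal_lt fun c hc => ?_
  have hsub : ∀ l ∈ Set.Ioc (0 : ℝ) c,
      ENNReal.ofReal t < volume {x | ENNReal.ofReal l < ‖f x‖ₑ} := by
    intro l hl
    by_contra hcon
    have h1 : MultiComm.rearrangement f t ≤ ENNReal.ofReal l := sInf_le (not_lt.1 hcon)
    have h2 : ENNReal.ofReal l ≤ c := by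
      rw [← ENNReal.ofReal_coe_nnreal]; exact ENNReal.ofReal_le_ofReal hl.2
    exact absurd hc (not_lt.2 (h1.trans h2))
  calc (c : ℝ≥0∞) = ∫⁻ l in Set.Ioc (0 : ℝ) c, 1 := by simp
    _ ≤ ∫⁻ l in Set.Ioc (0 : ℝ) c,
        {l : ℝ | ENNReal.ofReal t < volume {x | ENNReal.ofReal l < ‖f x‖ₑ}}.indicator 1 l := by
      refine setLIntegral_mono' measurableSet_Ioc fun l hl => ?_
      simp [hsub l hl]
    _ ≤ _ := lintegral_mono_set Set.Ioc_subset_Ioi_self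

theorem antitone_distribution (T : ℝ → ℝ≥0∞) :
    Antitone fun l : ℝ => volume {x | ENNReal.ofReal l < T x} :=
  fun _ _ h => measure_mono fun _ hx => (ENNReal.ofReal_le_ofReal h).trans_lt hx

/-- The `L^{2,1}` quasi-norm is bounded by the integral of the square root of the distribution
function. -/
theorem lorentzNorm_two_one_le_lintegral {E : Type*} [NormedAddCommGroup E] (f : ℝ → E) :
    MultiComm.lorentzNorm 2 1 f ≤
      2 * ∫⁻ l in Set.Ioi (0 : ℝ), volume {x | ENNReal.ofReal l < ‖f x‖ₑ} ^ (1 / 2 : ℝ) := by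
  set d : ℝ → ℝ≥0∞ := fun l => volume {x | ENNReal.ofReal l < ‖f x‖ₑ} with hd
  have hdm : Measurable d := (antitone_distribution fun x => ‖f x‖ₑ).measurable
  have hset : MeasurableSet {p : ℝ × ℝ | ENNReal.ofReal p.1 < d p.2} :=
    measurableSet_lt (by fun_prop) (by fun_prop)
  -- This is ∫₀^a t^{-1/2} dt = 2 a^{1/2}, applied with a the distribution function at l after
  -- exchanging t and l.
  have hinner : ∀ a : ℝ≥0∞, ∫⁻ t in Set.Ioi (0 : ℝ),
      ENNReal.ofReal (t ^ (-(1 / 2) : ℝ)) * {t : ℝ | ENNReal.ofReal t < a}.indicator 1 t ≤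
        2 * a ^ (1 / 2 : ℝ) := by
    intro a
    by_cases ha : a = ∞
    · rw [ha, ENNReal.top_rpow_of_pos (by norm_num)]; simp
    calc _ ≤ ∫⁻ t in Set.Ioi (0 : ℝ), (Set.Ioo 0 a.toReal).indicator
          (fun t => ENNReal.ofReal (t ^ (-(1 / 2) : ℝ))) t := by
          refine setLIntegral_mono' measurableSet_Ioi fun t ht => ?_
          by_cases h : ENNReal.ofReal t < a
          · rw [Set.indicator_of_mem (show t ∈ Set.Ioo 0 a.toReal from
                ⟨ht, (ENNReal.ofReal_lt_iff_lt_toReal (le_of_lt ht) ha).1 h⟩)]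
            simp [h]
          · simp [h]
      _ ≤ ∫⁻ t in Set.Ioo 0 a.toReal, ENNReal.ofReal (t ^ (-(1 / 2) : ℝ)) := by
          rw [← lintegral_indicator measurableSet_Ioo]
          exact setLIntegral_le_lintegral _ _
      _ = _ := by
          rw [lintegral_Ioo_rpow (by norm_num) ENNReal.toReal_nonneg]
          norm_num
          rw [div_eq_mul_inv, inv_div, div_one, ENNReal.ofReal_mul (by positivity),
            ← ENNReal.ofReal_rpow_of_nonneg ENNReal.toReal_nonneg (by norm_num),
            ENNReal.ofReal_toReal ha, mul_comm]
          simp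
  unfold MultiComm.lorentzNorm
  rw [div_one, ENNReal.rpow_one]
  calc _ ≤ ∫⁻ t in Set.Ioi (0 : ℝ), ∫⁻ l in Set.Ioi (0 : ℝ), ENNReal.ofReal (t ^ (-(1 / 2) : ℝ)) *
        {p : ℝ × ℝ | ENNReal.ofReal p.1 < d p.2}.indicator 1 (t, l) := by
        refine setLIntegral_mono' measurableSet_Ioi fun t ht => ?_
        have ht0 : (0 : ℝ) < t := ht
        rw [ENNReal.rpow_one, lintegral_const_mul' _ _ ENNReal.ofReal_ne_top, mul_right_comm,
          ← ENNReal.ofReal_mul (by positivity)]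
        have e : t ^ (1 / 2 : ℝ) * (1 / t) = t ^ (-(1 / 2) : ℝ) := by
          rw [one_div t, ← Real.rpow_neg_one t, ← Real.rpow_add ht0]; norm_num
        rw [e]
        exact mul_le_mul_right (rearrangement_le_lintegral f t) _
    _ = ∫⁻ l in Set.Ioi (0 : ℝ), ∫⁻ t in Set.Ioi (0 : ℝ), ENNReal.ofReal (t ^ (-(1 / 2) : ℝ)) *
        {p : ℝ × ℝ | ENNReal.ofReal p.1 < d p.2}.indicator 1 (t, l) := by
        refine lintegral_lintegral_swap (Measurable.aemeasurable ?_)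
        exact Measurable.mul (by fun_prop) (measurable_one.indicator hset)
    _ ≤ ∫⁻ l in Set.Ioi (0 : ℝ), 2 * d l ^ (1 / 2 : ℝ) := lintegral_mono fun l => hinner (d l)
    _ = _ := lintegral_const_mul' _ _ ENNReal.ofNat_ne_top

/-- The function `x ↦ |{T ≥ T(x)}|` is at least as spread out as the identity. -/
theorem measure_superlevel_rank_le (T : ℝ → ℝ≥0∞) (a : ℝ≥0∞) :
    volume {x | volume {y | T x ≤ T y} ≤ a} ≤ a := by
  set S : Set ℝ≥0∞ := {c | volume {y | c ≤ T y} ≤ a} with hS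
  rcases S.eq_empty_or_nonempty with hE | hne
  · have : {x | volume {y | T x ≤ T y} ≤ a} = ∅ := by
      ext x
      have : T x ∉ S := by rw [hE]; simp
      simpa [hS] using this
    rw [this]; simp
  obtain ⟨v, hv, hvt, hvS⟩ := exists_seq_tendsto_sInf hne (OrderBot.bddBelow S)
  -- The set to be measured is {T ∈ S}. If S contains its infimum, this set lies in one superlevel
  -- set; otherwise it lies in an increasing union of superlevel sets at levels v_k decreasing to
  -- the infimum.
  by_cases h0 : sInf S ∈ S
  · refine (measure_mono fun x hx => ?_).trans h0
    exact sInf_le (show T x ∈ S from hx)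
  · have hsub : {x | volume {y | T x ≤ T y} ≤ a} ⊆ ⋃ k, {y | v k ≤ T y} := by
      intro x hx
      have hxS : T x ∈ S := hx
      have hlt : sInf S < T x := lt_of_le_of_ne (sInf_le hxS) fun h => h0 (h ▸ hxS)
      obtain ⟨k, hk⟩ := (hvt.eventually_lt_const hlt).exists
      exact Set.mem_iUnion.2 ⟨k, hk.le⟩
    refine (measure_mono hsub).trans ?_
    have hmono : Monotone fun k => {y | v k ≤ T y} := fun i j hij y hy => (hv hij).trans hy
    rw [hmono.measure_iUnion]
    exact iSup_le hvS

/-- The extremal weight is the rank r(x) = |{T ≥ T(x)}|. On {T > l} it is at most d = |{T > l}|, so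
d^{1/2} = d·d^{-1/2} is at most the integral of r^{-1/2} over that set; integrate in l. Finiteness
excludes d = ∞, where d·d^{-1/2} would be 0. -/
theorem lintegral_sqrt_distribution_le_of_finite {T : ℝ → ℝ≥0∞} (hT : Measurable T)
    (hfin : ∀ l : ℝ, 0 < l → volume {x | ENNReal.ofReal l < T x} ≠ ∞) :
    ∫⁻ l in Set.Ioi (0 : ℝ), volume {x | ENNReal.ofReal l < T x} ^ (1 / 2 : ℝ) ≤
      ∫⁻ x, T x * (volume {y | T x ≤ T y})⁻¹ ^ (1 / 2 : ℝ) := by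
  set φ : ℝ → ℝ≥0∞ := fun x => (volume {y | T x ≤ T y})⁻¹ ^ (1 / 2 : ℝ) with hφ
  have hrm : Measurable fun x => volume {y | T x ≤ T y} := by
    have : Antitone fun c : ℝ≥0∞ => volume {y | c ≤ T y} :=
      fun _ _ h => measure_mono fun _ hx => h.trans hx
    exact this.measurable.comp hT
  have hφm : Measurable φ := hrm.inv.pow_const _
  have hset : MeasurableSet {p : ℝ × ℝ | ENNReal.ofReal p.2 < T p.1} :=
    measurableSet_lt (by fun_prop) (by fun_prop)
  calc _ ≤ ∫⁻ l in Set.Ioi (0 : ℝ), ∫⁻ x,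
        {p : ℝ × ℝ | ENNReal.ofReal p.2 < T p.1}.indicator 1 (x, l) * φ x := by
        refine setLIntegral_mono' measurableSet_Ioi fun l hl => ?_
        set d := volume {x | ENNReal.ofReal l < T x} with hd
        have hdt : d ≠ ∞ := hfin l hl
        have hms : MeasurableSet {x | ENNReal.ofReal l < T x} := measurableSet_lt measurable_const hT
        calc d ^ (1 / 2 : ℝ) ≤ d⁻¹ ^ (1 / 2 : ℝ) * d := by
              by_cases hd0 : d = 0
              · simp [hd0]
              · rw [ENNReal.inv_rpow, ← ENNReal.rpow_neg]
                nth_rw 3 [← ENNReal.rpow_one d]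
                rw [← ENNReal.rpow_add _ _ hd0 hdt]
                norm_num
          _ = ∫⁻ x, {x | ENNReal.ofReal l < T x}.indicator (fun _ => d⁻¹ ^ (1 / 2 : ℝ)) x := by
              rw [lintegral_indicator_const hms]
          _ ≤ _ := by
              refine lintegral_mono fun x => ?_
              by_cases hx : ENNReal.ofReal l < T x
              · simp only [Set.indicator_apply, Set.mem_ofPred, hx, if_true, Pi.one_apply, one_mul]
                refine ENNReal.rpow_le_rpow (ENNReal.inv_le_inv.2 ?_) (by norm_num)
                exact measure_mono fun y hy => hx.trans_le hy
              · simp [hx]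
    _ = ∫⁻ x, ∫⁻ l in Set.Ioi (0 : ℝ),
        {p : ℝ × ℝ | ENNReal.ofReal p.2 < T p.1}.indicator 1 (x, l) * φ x := by
        refine (lintegral_lintegral_swap (Measurable.aemeasurable ?_)).symm
        exact Measurable.mul (measurable_one.indicator hset) (by fun_prop)
    _ ≤ _ := by
        refine lintegral_mono fun x => ?_
        have hm : Measurable fun l : ℝ =>
            {p : ℝ × ℝ | ENNReal.ofReal p.2 < T p.1}.indicator (1 : ℝ × ℝ → ℝ≥0∞) (x, l) :=
          (measurable_one.indicator hset).comp (by fun_prop)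
        rw [lintegral_mul_const _ hm]
        refine mul_le_mul_left ?_ _
        by_cases hx : T x = ∞
        · rw [hx]; exact le_top
        calc _ ≤ ∫⁻ l, (Set.Ioo 0 (T x).toReal).indicator 1 l := by
              rw [← lintegral_indicator measurableSet_Ioi]
              refine lintegral_mono fun l => ?_
              by_cases h : 0 < l ∧ ENNReal.ofReal l < T x
              · rw [Set.indicator_of_mem (show l ∈ Set.Ioo 0 (T x).toReal from
                  ⟨h.1, (ENNReal.ofReal_lt_iff_lt_toReal h.1.le hx).1 h.2⟩)]
                exact Set.indicator_le_self' (by simp) _ |>.trans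
                  (Set.indicator_le_self' (by simp) _)
              · by_cases hl : 0 < l
                · have h' : ¬ ENNReal.ofReal l < T x := fun h' => h ⟨hl, h'⟩
                  simp [Set.indicator_apply, h']
                · simp [Set.indicator_apply, hl]
          _ = T x := by
              rw [lintegral_indicator_one measurableSet_Ioo, Real.volume_Ioo, sub_zero,
                ENNReal.ofReal_toReal hx]

/-- Truncating T to [-n, n] makes the distribution function finite; monotone convergence removes the
truncation. -/
theorem lintegral_sqrt_distribution_le {T : ℝ → ℝ≥0∞} (hT : Measurable T) {M : ℝ≥0∞}
    (h : ∀ r : ℝ → ℝ≥0∞, Measurable r → (∀ a : ℝ≥0∞, volume {x | r x ≤ a} ≤ a) →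
      ∫⁻ x, T x * (r x)⁻¹ ^ (1 / 2 : ℝ) ≤ M) :
    ∫⁻ l in Set.Ioi (0 : ℝ), volume {x | ENNReal.ofReal l < T x} ^ (1 / 2 : ℝ) ≤ M := by
  set I : ℕ → Set ℝ := fun n => Set.Icc (-(n : ℝ)) n with hI
  set Tn : ℕ → ℝ → ℝ≥0∞ := fun n => (I n).indicator T with hTn
  have hTnm : ∀ n, Measurable (Tn n) := fun n => hT.indicator measurableSet_Icc
  have hmem : ∀ n (l : ℝ) x, ENNReal.ofReal l < Tn n x ↔ x ∈ I n ∧ ENNReal.ofReal l < T x := by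
    intro n l x
    by_cases hx : x ∈ I n <;> simp [hTn, hx]
  have hle : ∀ n, ∫⁻ l in Set.Ioi (0 : ℝ), volume {x | ENNReal.ofReal l < Tn n x} ^ (1 / 2 : ℝ) ≤ M := by
    intro n
    refine (lintegral_sqrt_distribution_le_of_finite (hTnm n) fun l _ => ?_).trans ?_
    · refine ne_top_of_le_ne_top (b := volume (I n)) (by simp [hI]) (measure_mono fun x hx => ?_)
      exact ((hmem n l x).1 hx).1
    · have hrm : Measurable fun x => volume {y | Tn n x ≤ Tn n y} := by
        have : Antitone fun c : ℝ≥0∞ => volume {y | c ≤ Tn n y} :=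
          fun _ _ h => measure_mono fun _ hx => h.trans hx
        exact this.measurable.comp (hTnm n)
      refine le_trans (lintegral_mono fun x => ?_) (h _ hrm (measure_superlevel_rank_le _))
      exact mul_le_mul_left (Set.indicator_le_self _ _ _) _
  have hmono : ∀ l : ℝ, Monotone fun n => {x | ENNReal.ofReal l < Tn n x} := by
    intro l n k hnk x hx
    have := (hmem n l x).1 hx
    have hk : (n : ℝ) ≤ k := by exact_mod_cast hnk
    exact (hmem k l x).2 ⟨⟨by linarith [this.1.1], by linarith [this.1.2]⟩, this.2⟩
  have hun : ∀ l : ℝ, ⋃ n, {x | ENNReal.ofReal l < Tn n x} = {x | ENNReal.ofReal l < T x} := by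
    intro l
    ext x
    simp only [Set.mem_iUnion, Set.mem_ofPred, hmem]
    refine ⟨fun ⟨n, h⟩ => h.2, fun h => ?_⟩
    obtain ⟨n, hn⟩ := exists_nat_ge |x|
    exact ⟨n, abs_le.1 hn, h⟩
  refine le_of_tendsto' (lintegral_tendsto_of_tendsto_of_monotone
    (f := fun n l => volume {x | ENNReal.ofReal l < Tn n x} ^ (1 / 2 : ℝ)) (fun n => ?_) ?_ ?_) hle
  · exact ((antitone_distribution (Tn n)).measurable.pow_const _).aemeasurable
  · exact .of_forall fun l n k hnk => ENNReal.rpow_le_rpow (measure_mono (hmono l hnk)) (by norm_num)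
  · refine .of_forall fun l => ?_
    have := tendsto_measure_iUnion_atTop (μ := volume) (hmono l)
    rw [hun] at this
    exact (ENNReal.continuous_rpow_const.tendsto _).comp this

/-- Duality characterisation of `L^{2,1}`: it suffices to test against the weights `r^{-1/2}` with
`|{r ≤ a}| ≤ a`. -/
theorem lorentzNorm_two_one_le_of_forall {E : Type*} [NormedAddCommGroup E] {f : ℝ → E}
    {T : ℝ → ℝ≥0∞} (hT : AEMeasurable T volume) (hfT : ∀ᵐ x, ‖f x‖ₑ ≤ T x) {M : ℝ≥0∞}
    (h : ∀ r : ℝ → ℝ≥0∞, Measurable r → (∀ a : ℝ≥0∞, volume {x | r x ≤ a} ≤ a) →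
      ∫⁻ x, T x * (r x)⁻¹ ^ (1 / 2 : ℝ) ≤ M) :
    MultiComm.lorentzNorm 2 1 f ≤ 2 * M := by
  refine (lorentzNorm_two_one_le_lintegral f).trans (mul_le_mul_right ?_ _)
  refine le_trans (lintegral_mono fun l => ENNReal.rpow_le_rpow (measure_mono_ae ?_) (by norm_num))
    (lintegral_sqrt_distribution_le hT.measurable_mk fun r hr hrd => ?_)
  · filter_upwards [hfT, hT.ae_eq_mk] with x h1 h2 hx
    exact (lt_of_lt_of_le hx h1).trans_eq h2
  · refine le_trans (lintegral_mono_ae ?_) (h r hr hrd)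
    filter_upwards [hT.ae_eq_mk] with x h2
    rw [h2]

/-! ### Passage to matrices, with constants independent of m. -/

variable {m : ℕ}

theorem Matrix.frobenius_enorm_sq (A : Matrix (Fin m) (Fin m) ℝ) :
    ‖A‖ₑ ^ 2 = ∑ i, ∑ j, ‖A i j‖ₑ ^ 2 := by
  have h : ‖A‖ ^ 2 = ∑ i, ∑ j, ‖A i j‖ ^ 2 := by
    rw [Matrix.frobenius_norm_def, ← Real.rpow_natCast, ← Real.rpow_mul (by positivity)]
    norm_num
  rw [← ofReal_norm, ← ENNReal.ofReal_pow (norm_nonneg _), h,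
    ENNReal.ofReal_sum_of_nonneg fun i _ => by positivity]
  refine Finset.sum_congr rfl fun i _ => ?_
  rw [ENNReal.ofReal_sum_of_nonneg fun j _ => by positivity]
  refine Finset.sum_congr rfl fun j _ => ?_
  rw [ENNReal.ofReal_pow (norm_nonneg _), ofReal_norm]

theorem Matrix.enorm_entry_sq_le (A : Matrix (Fin m) (Fin m) ℝ) (i j : Fin m) :
    ‖A i j‖ₑ ^ 2 ≤ ‖A‖ₑ ^ 2 := by
  rw [Matrix.frobenius_enorm_sq]
  exact (Finset.single_le_sum (f := fun j => ‖A i j‖ₑ ^ 2) (fun _ _ => zero_le) (Finset.mem_univ j)).trans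
    (Finset.single_le_sum (f := fun i => ∑ j, ‖A i j‖ₑ ^ 2) (fun _ _ => zero_le) (Finset.mem_univ i))

theorem Matrix.norm_entry_le (A : Matrix (Fin m) (Fin m) ℝ) (i j : Fin m) : ‖A i j‖ ≤ ‖A‖ := by
  have h := Matrix.enorm_entry_sq_le A i j
  rw [← ofReal_norm, ← ofReal_norm, ← ENNReal.ofReal_pow (norm_nonneg _),
    ← ENNReal.ofReal_pow (norm_nonneg _), ENNReal.ofReal_le_ofReal_iff (by positivity)] at h
  exact le_of_sq_le_sq h (norm_nonneg _)

theorem Matrix.continuous_entry (i j : Fin m) :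
    Continuous fun A : Matrix (Fin m) (Fin m) ℝ => A i j :=
  (Matrix.entryLinearMap ℝ ℝ i j).continuous_of_finiteDimensional

theorem Matrix.continuous_mul_transpose :
    Continuous fun p : Matrix (Fin m) (Fin m) ℝ × Matrix (Fin m) (Fin m) ℝ => p.1 * p.2ᵀ := by
  let _ : NormedRing (Matrix (Fin m) (Fin m) ℝ) := Matrix.frobeniusNormedRing
  have ht : Continuous fun A : Matrix (Fin m) (Fin m) ℝ => Aᵀ :=
    (Matrix.transposeLinearEquiv (Fin m) (Fin m) ℝ ℝ).toLinearMap.continuous_of_finiteDimensional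
  exact continuous_fst.mul (ht.comp continuous_snd)

theorem Matrix.enorm_mul_transpose_le (A B : Matrix (Fin m) (Fin m) ℝ) :
    ‖A * Bᵀ‖ₑ ≤ ‖A‖ₑ * ‖B‖ₑ := by
  rw [← ofReal_norm, ← ofReal_norm, ← ofReal_norm, ← ENNReal.ofReal_mul (norm_nonneg _)]
  refine ENNReal.ofReal_le_ofReal ((Matrix.frobenius_norm_mul A Bᵀ).trans ?_)
  rw [Matrix.frobenius_norm_transpose]

theorem MeasureTheory.LocallyIntegrable.matrix_entry {U : ℝ → Matrix (Fin m) (Fin m) ℝ}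
    (hU : LocallyIntegrable U volume) (i j : Fin m) :
    LocallyIntegrable (fun x => U x i j) volume := by
  intro x
  obtain ⟨S, hS, hi⟩ := hU x
  exact ⟨S, hS, Integrable.mono hi ((Matrix.continuous_entry i j).comp_aestronglyMeasurable hi.1)
    (Eventually.of_forall fun y => Matrix.norm_entry_le _ i j)⟩

/-- Because this is an identity, summing the scalar estimates over entries costs no factor depending
on m. -/
theorem lintegral_weight_frobenius {U : ℝ → Matrix (Fin m) (Fin m) ℝ}
    (hU : ∀ i j, AEMeasurable (fun x => U x i j) volume) {w : ℝ → ℝ≥0∞} (hw : AEMeasurable w volume) :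
    ∫⁻ x, w x * ‖U x‖ₑ ^ 2 = ∑ i, ∑ j, ∫⁻ x, w x * ‖U x i j‖ₑ ^ 2 := by
  have hm : ∀ i j, AEMeasurable (fun x => w x * ‖U x i j‖ₑ ^ 2) volume := fun i j =>
    hw.mul ((hU i j).enorm.pow_const 2)
  simp only [Matrix.frobenius_enorm_sq, Finset.mul_sum]
  rw [lintegral_finsetSum' _ fun i _ => Finset.aemeasurable_fun_sum _ fun j _ => hm i j]
  refine Finset.sum_congr rfl fun i _ => ?_
  rw [lintegral_finsetSum' _ fun j _ => hm i j]

theorem lintegral_frobenius {U : ℝ → Matrix (Fin m) (Fin m) ℝ}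
    (hU : ∀ i j, AEMeasurable (fun x => U x i j) volume) :
    ∫⁻ x, ‖U x‖ₑ ^ 2 = ∑ i, ∑ j, ∫⁻ x, ‖U x i j‖ₑ ^ 2 := by
  simpa using lintegral_weight_frobenius hU (w := fun _ => 1) aemeasurable_const

theorem measurable_lintegral_translate_sub {E : Type*} [NormedAddCommGroup E] {u : ℝ → E}
    (hu : AEStronglyMeasurable u volume) : Measurable fun t => ∫⁻ x, ‖u (x + t) - u x‖ₑ ^ 2 := by
  have hae := hu.ae_eq_mk
  set v := hu.mk u
  have hv : StronglyMeasurable v := hu.stronglyMeasurable_mk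
  have e : ∀ t, ∫⁻ x, ‖u (x + t) - u x‖ₑ ^ 2 = ∫⁻ x, ‖v (x + t) - v x‖ₑ ^ 2 := fun t => by
    have ht := (measurePreserving_add_right volume t).quasiMeasurePreserving.ae hae
    refine lintegral_congr_ae ?_
    filter_upwards [hae, ht] with y h1 h2
    rw [h1, h2]
  simp only [e]
  have : Measurable fun p : ℝ × ℝ => ‖v (p.2 + p.1) - v p.2‖ₑ ^ 2 :=
    ((hv.comp_measurable (measurable_snd.add measurable_fst)).sub
      (hv.comp_measurable measurable_snd)).enorm.pow_const 2
  exact this.lintegral_prod_right'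

/-- Weighted `L²` bound for a matrix valued function by the `L²` norm of its fractional Laplacian. -/
theorem weighted_fracLaplacian_bound {s : ℝ} (hs0 : 0 < s) (hs1 : s < 1 / 2) :
    ∃ C : ℝ≥0, ∀ r : ℝ → ℝ≥0∞, Measurable r → (∀ a : ℝ≥0∞, volume {x | r x ≤ a} ≤ a) →
      ∀ (m : ℕ) (U V : ℝ → Matrix (Fin m) (Fin m) ℝ),
      (∀ i j, MultiComm.HasFracLaplacian s (fun x => U x i j) (fun x => V x i j)) →
      ∫⁻ x, ‖V x‖ₑ ^ 2 < ∞ →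
      ∫⁻ x, (r x)⁻¹ ^ (2 * s) * ‖U x‖ₑ ^ 2 ≤ C * ∫⁻ x, ‖V x‖ₑ ^ 2 := by
  obtain ⟨C, hC⟩ := weighted_hardy hs0 hs1
  refine ⟨C * (1 / (2 - 2 * s) + 2 / s).toNNReal, ?_⟩
  intro r hr hrd m U V h hV
  have hVl : ∀ i j, LocallyIntegrable (fun x => V x i j) volume := fun i j => by
    obtain ⟨F, h1, h2⟩ := h i j
    exact h2.1
  have hV2 : ∀ i j, MemLp (fun x => V x i j) 2 := fun i j => by
    refine ⟨(hVl i j).aestronglyMeasurable, ?_⟩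
    have h1 : eLpNorm (fun x => V x i j) 2 volume ^ 2 < ∞ := by
      rw [eLpNorm_two_sq]
      exact (lintegral_mono fun x => Matrix.enorm_entry_sq_le _ i j).trans_lt hV
    exact (ENNReal.pow_lt_top_iff.1 h1).resolve_right (by norm_num)
  have hest := fun i j => fracLaplacian_estimates hs0 (by linarith) (h i j) (hV2 i j)
  rw [lintegral_weight_frobenius (fun i j => (hest i j).1.aestronglyMeasurable.aemeasurable)
      (w := fun x => (r x)⁻¹ ^ (2 * s)) (hr.inv.pow_const _).aemeasurable,
    lintegral_frobenius (fun i j => (hVl i j).aestronglyMeasurable.aemeasurable), Finset.mul_sum]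
  refine Finset.sum_le_sum fun i _ => ?_
  rw [Finset.mul_sum]
  refine Finset.sum_le_sum fun j _ => ?_
  obtain ⟨h1, h2, h3⟩ := hest i j
  refine (hC r hr hrd _ h1 h2).trans ((mul_le_mul_right h3 _).trans (le_of_eq ?_))
  rw [ENNReal.coe_mul, mul_assoc]
  rfl

/-- Weighted `L²` bound for a square integrable matrix valued function by its Gagliardo seminorm. -/
theorem weighted_gagliardo_bound {s : ℝ} (hs0 : 0 < s) (hs1 : s < 1 / 2) :
    ∃ C : ℝ≥0, ∀ r : ℝ → ℝ≥0∞, Measurable r → (∀ a : ℝ≥0∞, volume {x | r x ≤ a} ≤ a) →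
      ∀ (m : ℕ) (U : ℝ → Matrix (Fin m) (Fin m) ℝ), LocallyIntegrable U volume →
      ∫⁻ x, ‖U x‖ₑ ^ 2 < ∞ →
      ∫⁻ x, (r x)⁻¹ ^ (2 * s) * ‖U x‖ₑ ^ 2 ≤ C * ∫⁻ t in Set.Ioi (0 : ℝ),
        (∫⁻ x, ‖U (x + t) - U x‖ₑ ^ 2) * ENNReal.ofReal (t ^ (-1 - 2 * s)) := by
  obtain ⟨C, hC⟩ := weighted_hardy hs0 hs1
  refine ⟨C, ?_⟩
  intro r hr hrd m U hU hU2
  have hUl := fun i j => hU.matrix_entry i j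
  have hUm : ∀ i j, AEMeasurable (fun x => U x i j) volume := fun i j =>
    (hUl i j).aestronglyMeasurable.aemeasurable
  have hmean : ∀ i j x, Tendsto (fun ρ => fwdMean (fun x => U x i j) ρ x) atTop (𝓝 0) := by
    intro i j x
    have h2 : MemLp (fun x => U x i j) 2 := by
      refine ⟨(hUl i j).aestronglyMeasurable, ?_⟩
      have h1 : eLpNorm (fun x => U x i j) 2 volume ^ 2 < ∞ := by
        rw [eLpNorm_two_sq]
        exact (lintegral_mono fun x => Matrix.enorm_entry_sq_le _ i j).trans_lt hU2
      exact (ENNReal.pow_lt_top_iff.1 h1).resolve_right (by norm_num)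
    exact tendsto_mean_of_memLp h2 x
  have hshift : ∀ t i j, AEMeasurable (fun x => (U (x + t) - U x) i j) volume := fun t i j =>
    ((hUl i j).aestronglyMeasurable.comp_measurePreserving
      (measurePreserving_add_right volume t)).aemeasurable.sub (hUm i j)
  have hBm : ∀ i j, Measurable fun t => ∫⁻ x, ‖(U (x + t) - U x) i j‖ₑ ^ 2 := fun i j =>
    measurable_lintegral_translate_sub (hUl i j).aestronglyMeasurable
  have hR : ∫⁻ t in Set.Ioi (0 : ℝ),
      (∫⁻ x, ‖U (x + t) - U x‖ₑ ^ 2) * ENNReal.ofReal (t ^ (-1 - 2 * s)) =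
      ∑ i, ∑ j, ∫⁻ t in Set.Ioi (0 : ℝ),
        (∫⁻ x, ‖(U (x + t) - U x) i j‖ₑ ^ 2) * ENNReal.ofReal (t ^ (-1 - 2 * s)) := by
    have hm : ∀ i j, Measurable fun t => (∫⁻ x, ‖(U (x + t) - U x) i j‖ₑ ^ 2) *
        ENNReal.ofReal (t ^ (-1 - 2 * s)) := fun i j => (hBm i j).mul (by fun_prop)
    simp only [lintegral_frobenius (hshift _), Finset.sum_mul]
    rw [lintegral_finsetSum _ fun i _ => Finset.measurable_fun_sum _ fun j _ => hm i j]
    refine Finset.sum_congr rfl fun i _ => ?_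
    rw [lintegral_finsetSum _ fun j _ => hm i j]
  rw [lintegral_weight_frobenius hUm (w := fun x => (r x)⁻¹ ^ (2 * s)) (hr.inv.pow_const _).aemeasurable, hR, Finset.mul_sum]
  refine Finset.sum_le_sum fun i _ => ?_
  rw [Finset.mul_sum]
  refine Finset.sum_le_sum fun j _ => ?_
  exact hC r hr hrd _ (hUl i j) (hmean i j)

/-! ### Second differences and the double integral in h and t. -/

theorem lintegral_second_difference_le_left {E : Type*} [NormedAddCommGroup E] {P : ℝ → E}
    (hP : AEStronglyMeasurable P volume) (h t : ℝ) :
    ∫⁻ x, ‖(P (x + t + h) - P (x + t)) - (P (x + h) - P x)‖ₑ ^ 2 ≤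
      8 * ∫⁻ x, ‖P (x + h) - P x‖ₑ ^ 2 := by
  have hm : AEMeasurable (fun x => ‖P (x + h) - P x‖ₑ ^ 2) volume :=
    ((hP.comp_measurePreserving (measurePreserving_add_right volume h)).sub hP).enorm.pow_const 2
  calc _ ≤ ∫⁻ x, 4 * (‖P (x + t + h) - P (x + t)‖ₑ ^ 2 + ‖P (x + h) - P x‖ₑ ^ 2) := by
        refine lintegral_mono fun x => ?_
        exact (pow_le_pow_left' enorm_sub_le 2).trans (ENNReal.add_sq_le_four_mul _ _)
    _ = _ := by
        rw [lintegral_const_mul' _ _ ENNReal.ofNat_ne_top, lintegral_add_right' _ hm,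
          lintegral_add_right_eq_self (fun x => ‖P (x + h) - P x‖ₑ ^ 2) t]
        ring

/-- The second difference is symmetric in h and t, so the one-sided bound applies with either
increment. -/
theorem lintegral_second_difference_le_min {E : Type*} [NormedAddCommGroup E] {P : ℝ → E}
    (hP : AEStronglyMeasurable P volume) (h t : ℝ) :
    ∫⁻ x, ‖(P (x + t + h) - P (x + t)) - (P (x + h) - P x)‖ₑ ^ 2 ≤
      8 * min (∫⁻ x, ‖P (x + h) - P x‖ₑ ^ 2) (∫⁻ x, ‖P (x + t) - P x‖ₑ ^ 2) := by
  rcases min_choice (∫⁻ x, ‖P (x + h) - P x‖ₑ ^ 2) (∫⁻ x, ‖P (x + t) - P x‖ₑ ^ 2) with e | e <;> rw [e]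
  · exact lintegral_second_difference_le_left hP h t
  · refine le_trans (le_of_eq (lintegral_congr fun x => ?_))
      (lintegral_second_difference_le_left hP t h)
    rw [add_right_comm x t h]
    congr 2
    abel

theorem lintegral_abs_gt_rpow {p t : ℝ} (hp : p < -1) (ht : 0 < t) :
    ∫⁻ h, {h : ℝ | t < |h|}.indicator (fun h => ENNReal.ofReal (|h| ^ p)) h ≤
      2 * ENNReal.ofReal (t ^ (p + 1) / (-(p + 1))) := by
  have hset : {h : ℝ | t < |h|} ⊆ Set.Ioi t ∪ Neg.neg ⁻¹' Set.Ioi t := by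
    intro h hh
    rcases lt_abs.1 (show t < |h| from hh) with h1 | h1
    · exact Or.inl h1
    · exact Or.inr h1
  rw [lintegral_indicator (measurableSet_lt measurable_const (by fun_prop))]
  refine (lintegral_mono_set hset).trans ((lintegral_union_le _ _ _).trans ?_)
  have h1 : ∫⁻ h in Set.Ioi t, ENNReal.ofReal (|h| ^ p) =
      ENNReal.ofReal (t ^ (p + 1) / (-(p + 1))) := by
    rw [← lintegral_Ioi_rpow hp ht]
    refine setLIntegral_congr_fun measurableSet_Ioi fun h hh => ?_
    rw [abs_of_pos (ht.trans hh)]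
  have h2 : ∫⁻ h in Neg.neg ⁻¹' Set.Ioi t, ENNReal.ofReal (|h| ^ p) =
      ∫⁻ h in Set.Ioi t, ENNReal.ofReal (|h| ^ p) := by
    rw [← (Measure.measurePreserving_neg (volume : Measure ℝ)).setLIntegral_comp_preimage
      measurableSet_Ioi (by fun_prop)]
    simp only [abs_neg]
  rw [h2, h1, two_mul]

/-- Split at t = |h|. For t > |h| use B(h) and integrate t^{-2+2s} in t, which needs s < 1/2. For t
< |h| use B(t), exchange the integrals and integrate |h|^{-1-2s} in h, which needs s > 0. Both
produce the weight of order -2. -/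
theorem lintegral_lintegral_min_le {s : ℝ} (hs0 : 0 < s) (hs1 : s < 1 / 2) {B : ℝ → ℝ≥0∞}
    (hB : Measurable B) :
    ∫⁻ h : ℝ, ENNReal.ofReal (|h| ^ (-1 - 2 * s)) * ∫⁻ t in Set.Ioi (0 : ℝ),
        min (B h) (B t) * ENNReal.ofReal (t ^ (-1 - 2 * (1 / 2 - s))) ≤
      ENNReal.ofReal (1 / (1 - 2 * s) + 1 / s) *
        ∫⁻ h : ℝ, ENNReal.ofReal (|h| ^ (-2 : ℝ)) * B h := by
  have hs2 : 0 < 1 - 2 * s := by linarith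
  have e1 : -1 - 2 * (1 / 2 - s) = -2 + 2 * s := by ring
  rw [e1]
  have hset : MeasurableSet {p : ℝ × ℝ | p.2 < |p.1|} :=
    measurableSet_lt measurable_snd (by fun_prop)
  have hne : ∀ᵐ h : ℝ, h ≠ 0 := measure_eq_zero_iff_ae_notMem.1 (Real.volume_singleton (a := 0))
  have hfar : ∀ᵐ h : ℝ, ENNReal.ofReal (|h| ^ (-1 - 2 * s)) *
      ∫⁻ t in Set.Ioi |h|, B h * ENNReal.ofReal (t ^ (-2 + 2 * s)) =
      ENNReal.ofReal (1 / (1 - 2 * s)) * (ENNReal.ofReal (|h| ^ (-2 : ℝ)) * B h) := by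
    filter_upwards [hne] with h h0
    have ha : 0 < |h| := abs_pos.2 h0
    rw [lintegral_const_mul _ (by fun_prop), lintegral_Ioi_rpow (by linarith) ha, mul_left_comm,
      ← ENNReal.ofReal_mul (by positivity), mul_comm (B h), ← mul_assoc,
      ← ENNReal.ofReal_mul (by positivity)]
    congr 2
    have e : |h| ^ (-2 : ℝ) = |h| ^ (-1 - 2 * s) * |h| ^ (-2 + 2 * s + 1) := by
      rw [← Real.rpow_add ha]; congr 1; ring
    rw [e, show -(-2 + 2 * s + 1) = 1 - 2 * s by ring]
    ring
  have hF : Measurable fun p : ℝ × ℝ => {p : ℝ × ℝ | p.2 < |p.1|}.indicator (fun p =>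
      ENNReal.ofReal (|p.1| ^ (-1 - 2 * s)) * (B p.2 * ENNReal.ofReal (p.2 ^ (-2 + 2 * s)))) p :=
    Measurable.indicator (by fun_prop) hset
  have hnear : ∫⁻ h : ℝ, ∫⁻ t in Set.Ioi (0 : ℝ), {p : ℝ × ℝ | p.2 < |p.1|}.indicator (fun p =>
      ENNReal.ofReal (|p.1| ^ (-1 - 2 * s)) * (B p.2 * ENNReal.ofReal (p.2 ^ (-2 + 2 * s)))) (h, t) ≤
      ENNReal.ofReal (1 / s) * ∫⁻ h : ℝ, ENNReal.ofReal (|h| ^ (-2 : ℝ)) * B h := by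
    rw [lintegral_lintegral_swap hF.aemeasurable]
    calc _ ≤ ∫⁻ t in Set.Ioi (0 : ℝ), ENNReal.ofReal (1 / s) * (ENNReal.ofReal (|t| ^ (-2 : ℝ)) * B t) := by
          refine setLIntegral_mono' measurableSet_Ioi fun t ht => ?_
          have ht0 : 0 < t := ht
          calc _ = ∫⁻ h, (B t * ENNReal.ofReal (t ^ (-2 + 2 * s))) *
                {h : ℝ | t < |h|}.indicator (fun h => ENNReal.ofReal (|h| ^ (-1 - 2 * s))) h := by
                refine lintegral_congr fun h => ?_
                by_cases hh : t < |h|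
                · simp [hh, mul_comm]
                · simp [hh]
            _ ≤ (B t * ENNReal.ofReal (t ^ (-2 + 2 * s))) *
                (2 * ENNReal.ofReal (t ^ (-1 - 2 * s + 1) / (-(-1 - 2 * s + 1)))) := by
                rw [lintegral_const_mul _ (Measurable.indicator (by fun_prop)
                  (measurableSet_lt measurable_const (by fun_prop)))]
                exact mul_le_mul_right (lintegral_abs_gt_rpow (by linarith) ht0) _
            _ = _ := by
                have e : 2 * (t ^ (-1 - 2 * s + 1) / (-(-1 - 2 * s + 1))) * t ^ (-2 + 2 * s) =
                    1 / s * t ^ (-2 : ℝ) := by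
                  have e3 : t ^ (-2 : ℝ) = t ^ (-1 - 2 * s + 1) * t ^ (-2 + 2 * s) := by
                    rw [← Real.rpow_add ht0]; congr 1; ring
                  rw [e3, show -(-1 - 2 * s + 1) = 2 * s by ring]
                  field_simp
                rw [abs_of_pos ht0, ← mul_assoc (ENNReal.ofReal (1 / s)), ← ENNReal.ofReal_mul (by positivity), ← e,
                  ENNReal.ofReal_mul (by
                    rw [show -(-1 - 2 * s + 1) = 2 * s by ring]; positivity),
                  ENNReal.ofReal_mul zero_le_two, ENNReal.ofReal_ofNat]
                ring
      _ ≤ _ := by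
          rw [← lintegral_const_mul _ (by fun_prop)]
          exact setLIntegral_le_lintegral _ _
  calc _ ≤ ∫⁻ h : ℝ, (ENNReal.ofReal (|h| ^ (-1 - 2 * s)) *
        (∫⁻ t in Set.Ioi |h|, B h * ENNReal.ofReal (t ^ (-2 + 2 * s))) +
        ∫⁻ t in Set.Ioi (0 : ℝ), {p : ℝ × ℝ | p.2 < |p.1|}.indicator (fun p =>
      ENNReal.ofReal (|p.1| ^ (-1 - 2 * s)) * (B p.2 * ENNReal.ofReal (p.2 ^ (-2 + 2 * s)))) (h, t)) := by
        refine lintegral_mono fun h => ?_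
        have hsub : Set.Ioi (0 : ℝ) ⊆ Set.Ici |h| ∪ Set.Ioo 0 |h| := by
          intro t ht
          rcases le_or_gt |h| t with h1 | h1
          · exact Or.inl h1
          · exact Or.inr ⟨ht, h1⟩
        have h1 : ∫⁻ t in Set.Ioi (0 : ℝ), min (B h) (B t) * ENNReal.ofReal (t ^ (-2 + 2 * s)) ≤
            (∫⁻ t in Set.Ioi |h|, B h * ENNReal.ofReal (t ^ (-2 + 2 * s))) +
              ∫⁻ t in Set.Ioo 0 |h|, B t * ENNReal.ofReal (t ^ (-2 + 2 * s)) := by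
          refine (lintegral_mono_set hsub).trans ((lintegral_union_le _ _ _).trans ?_)
          rw [setLIntegral_congr (Ioi_ae_eq_Ici (a := |h|)).symm]
          refine add_le_add (lintegral_mono fun t => ?_) (lintegral_mono fun t => ?_)
          · exact mul_le_mul_left (min_le_left _ _) _
          · exact mul_le_mul_left (min_le_right _ _) _
        refine (mul_le_mul_right h1 _).trans ?_
        rw [mul_add]
        refine add_le_add_right ?_ _
        rw [← lintegral_const_mul _ (by fun_prop), ← lintegral_indicator measurableSet_Ioo,
          ← lintegral_indicator measurableSet_Ioi]
        refine lintegral_mono fun t => ?_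
        by_cases ht : t ∈ Set.Ioo 0 |h|
        · rw [Set.indicator_of_mem ht, Set.indicator_of_mem (show t ∈ Set.Ioi 0 from ht.1)]
          simp [ht.2]
        · rw [Set.indicator_of_notMem ht]
          exact zero_le
    _ ≤ _ := by
        rw [lintegral_add_right _ hF.lintegral_prod_right', lintegral_congr_ae hfar,
          lintegral_const_mul _ (by fun_prop), ENNReal.ofReal_add (by positivity) (by positivity),
          add_mul]
        exact add_le_add_right hnear _

/-! ### The commutator against an admissible weight, and the conclusion. -/

theorem ENNReal.le_of_sq_le_sq {a b : ℝ≥0∞} (h : a ^ 2 ≤ b ^ 2) : a ≤ b :=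
  le_of_not_gt fun hc => absurd h (not_le.2 (ENNReal.pow_right_strictMono two_ne_zero hc))

theorem ENNReal.sqrt_rpow_sq (a : ℝ≥0∞) : (a ^ (1 / 2 : ℝ)) ^ 2 = a := by
  rw [← ENNReal.rpow_natCast, ← ENNReal.rpow_mul]; norm_num

theorem kernelNorm_sq {E : Type*} [NormedAddCommGroup E] (s : ℝ) (G : ℝ × ℝ → E) :
    MultiComm.kernelNorm (-s) 2 2 G ^ 2 = ∫⁻ h : ℝ, ENNReal.ofReal (|h| ^ (1 + 2 * s)) *
      ∫⁻ x, ‖G (x, x + h)‖ₑ ^ 2 := by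
  unfold MultiComm.kernelNorm
  rw [ENNReal.sqrt_rpow_sq]
  refine lintegral_congr fun h => ?_
  rw [ENNReal.ofReal_ofNat, ENNReal.rpow_ofNat, eLpNorm_two_sq]
  simp only [MultiComm.slice, mul_neg, sub_neg_eq_add]

theorem sobolevHalfSeminorm_sq {E : Type*} [NormedAddCommGroup E] (P : ℝ → E) :
    MultiComm.sobolevHalfSeminorm P ^ 2 = ∫⁻ h : ℝ, ENNReal.ofReal (|h| ^ (-2 : ℝ)) *
      ∫⁻ x, ‖P (x + h) - P x‖ₑ ^ 2 := by
  unfold MultiComm.sobolevHalfSeminorm MultiComm.besovSeminorm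
  rw [ENNReal.sqrt_rpow_sq]
  refine lintegral_congr fun h => ?_
  rw [ENNReal.ofReal_ofNat, ENNReal.rpow_ofNat, eLpNorm_two_sq]
  norm_num

/-- If `∫ w g < ∞` for a weight that is positive off the origin, then `g` is finite a.e. -/
theorem ae_lt_top_of_weighted {p : ℝ} {g : ℝ → ℝ≥0∞} (hg : AEMeasurable g volume)
    (h : ∫⁻ x : ℝ, ENNReal.ofReal (|x| ^ p) * g x ≠ ∞) : ∀ᵐ x, g x < ∞ := by
  have hm : AEMeasurable (fun x : ℝ => ENNReal.ofReal (|x| ^ p) * g x) volume :=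
    AEMeasurable.mul (by fun_prop) hg
  have hne : ∀ᵐ x : ℝ, x ≠ 0 := measure_eq_zero_iff_ae_notMem.1 (Real.volume_singleton (a := 0))
  filter_upwards [ae_lt_top' hm h, hne] with x h1 h0
  have hp : 0 < |x| ^ p := Real.rpow_pos_of_pos (abs_pos.2 h0) p
  by_contra hc
  rw [not_lt_top_iff.1 hc, ENNReal.mul_top (by simpa using hp)] at h1
  exact lt_irrefl _ h1

theorem aestronglyMeasurable_shear {E : Type*} [NormedAddCommGroup E] {G : ℝ × ℝ → E}
    (hG : AEStronglyMeasurable G volume) :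
    AEStronglyMeasurable (fun p : ℝ × ℝ => G (p.1, p.1 + p.2)) volume :=
  hG.comp_measurePreserving (measurePreserving_prod_add (volume : Measure ℝ) (volume : Measure ℝ))

theorem lintegral_weighted_mul_sq_le {a b w₁ w₂ : ℝ → ℝ≥0∞}
    (ha : AEMeasurable a volume) (hb : AEMeasurable b volume) (hw₁ : AEMeasurable w₁ volume)
    (hw₂ : AEMeasurable w₂ volume) :
    (∫⁻ x, (w₁ x * a x) * (w₂ x * b x)) ^ 2 ≤
      (∫⁻ x, w₁ x ^ 2 * a x ^ 2) * ∫⁻ x, w₂ x ^ 2 * b x ^ 2 := by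
  simpa only [Pi.mul_apply, mul_pow] using lintegral_mul_sq_le (hw₁.mul ha) (hw₂.mul hb)

theorem ENNReal.rpow_sq (a : ℝ≥0∞) (p : ℝ) : (a ^ p) ^ 2 = a ^ (2 * p) := by
  rw [← ENNReal.rpow_natCast, ← ENNReal.rpow_mul, mul_comm]; norm_num

/-- The commutator tested against a weight of `L^{2,∞}` type. -/
theorem commutator_weighted_bound {s : ℝ} (hs0 : 0 < s) (hs1 : s < 1 / 2) :
    ∃ A : ℝ≥0, ∀ (m : ℕ) (K G : ℝ × ℝ → Matrix (Fin m) (Fin m) ℝ)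
      (P : ℝ → Matrix (Fin m) (Fin m) ℝ), LocallyIntegrable K volume →
      MultiComm.HasKernelFracLaplacian s K G → MultiComm.kernelNorm (-s) 2 2 G < ∞ →
      MultiComm.MemSobolevHalf P → ∀ r : ℝ → ℝ≥0∞, Measurable r →
      (∀ a : ℝ≥0∞, volume {x | r x ≤ a} ≤ a) →
      ∫⁻ x, (∫⁻ y, ‖P x - P y‖ₑ * ‖K (x, y)‖ₑ) * (r x)⁻¹ ^ (1 / 2 : ℝ) ≤
        A * MultiComm.kernelNorm (-s) 2 2 G * MultiComm.sobolevHalfSeminorm P := by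
  obtain ⟨C₁, hC₁⟩ := weighted_fracLaplacian_bound hs0 hs1
  obtain ⟨C₂, hC₂⟩ := weighted_gagliardo_bound (s := 1 / 2 - s) (by linarith) (by linarith)
  set A : ℝ≥0∞ := C₁ * (C₂ * 8 * ENNReal.ofReal (1 / (1 - 2 * s) + 1 / s)) with hA
  have hAt : A ≠ ∞ := by finiteness
  refine ⟨(A ^ (1 / 2 : ℝ)).toNNReal, ?_⟩
  intro m K G P hK hKG hG hP r hr hrd
  rw [ENNReal.coe_toNNReal (ENNReal.rpow_ne_top_of_nonneg (by norm_num) hAt)]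
  set B : ℝ → ℝ≥0∞ := fun t => ∫⁻ x, ‖P (x + t) - P x‖ₑ ^ 2 with hBdef
  have hPm : AEStronglyMeasurable P volume := hP.1.aestronglyMeasurable
  have hB : Measurable B := measurable_lintegral_translate_sub hPm
  have hKm := aestronglyMeasurable_shear hK.aestronglyMeasurable
  have hGm := aestronglyMeasurable_shear hKG.1
  set γ : ℝ → ℝ≥0∞ := fun h => ∫⁻ x, ‖G (x, x + h)‖ₑ ^ 2 with hγ
  have hγm : AEMeasurable γ volume := (hGm.enorm.pow_const 2).lintegral_prod_left'
  have hPshift : AEStronglyMeasurable (fun p : ℝ × ℝ => P p.1 - P (p.1 + p.2)) volume := by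
    have h1 : AEStronglyMeasurable (fun p : ℝ × ℝ => P p.1 - P p.2) volume :=
      (hPm.comp_fst (ν := volume)).sub (hPm.comp_snd (μ := volume))
    exact aestronglyMeasurable_shear h1
  set q : ℝ → ℝ≥0∞ := fun h => ∫⁻ t in Set.Ioi (0 : ℝ),
        min (B h) (B t) * ENNReal.ofReal (t ^ (-1 - 2 * (1 / 2 - s))) with hq
  have hqm : Measurable q := by
    have : Measurable fun p : ℝ × ℝ => min (B p.1) (B p.2) *
      ENNReal.ofReal (p.2 ^ (-1 - 2 * (1 / 2 - s))) := by fun_prop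
    exact this.lintegral_prod_right'
  have hkn := kernelNorm_sq s G
  have hsn := sobolevHalfSeminorm_sq P
  have hγfin : ∀ᵐ h, γ h < ∞ := ae_lt_top_of_weighted hγm
    (p := 1 + 2 * s) (by rw [← hkn]; exact ENNReal.pow_ne_top hG.ne)
  -- For a.e. h this makes P(·+h) - P square integrable, which supplies the decay of means required
  -- by Hardy's inequality.
  have hBfin : ∀ᵐ h, B h < ∞ := ae_lt_top_of_weighted hB.aemeasurable
    (p := -2) (by rw [← hsn]; exact ENNReal.pow_ne_top hP.2.ne)
  have hsliceK : ∀ᵐ h : ℝ, ∫⁻ x, (r x)⁻¹ ^ (2 * s) * ‖K (x, x + h)‖ₑ ^ 2 ≤ C₁ * γ h := by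
    filter_upwards [hKG.2, hγfin] with h h1 h2
    exact hC₁ r hr hrd m (MultiComm.slice K h) (MultiComm.slice G h) h1 h2
  have hsliceP : ∀ᵐ h : ℝ, ∫⁻ x, (r x)⁻¹ ^ (2 * (1 / 2 - s)) * ‖P x - P (x + h)‖ₑ ^ 2 ≤
      C₂ * 8 * q h := by
    filter_upwards [hBfin] with h h2
    have hloc : LocallyIntegrable (fun x => P (x + h) - P x) volume := by
      refine LocallyIntegrable.sub ?_ hP.1
      intro x
      obtain ⟨U, hU, hi⟩ := hP.1 (x + h)
      refine ⟨(fun y => y + h) ⁻¹' U, (continuous_add_const h).continuousAt.preimage_mem_nhds hU, ?_⟩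
      exact ((measurePreserving_add_right volume h).integrableOn_comp_preimage
        (MeasurableEquiv.addRight h).measurableEmbedding).2 hi
    have h3 := hC₂ r hr hrd m (fun x => P (x + h) - P x) hloc h2
    simp only [enorm_sub_rev (P _) (P (_ + h))]
    refine h3.trans ?_
    rw [mul_assoc, hq, ← lintegral_const_mul' 8 _ ENNReal.ofNat_ne_top]
    refine mul_le_mul_right (lintegral_mono fun t => ?_) _
    dsimp only
    rw [← mul_assoc]
    exact mul_le_mul_left (lintegral_second_difference_le_min hPm h t) _
  have hKh : ∀ᵐ h : ℝ, AEMeasurable (fun x => ‖K (x, x + h)‖ₑ) volume := by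
    filter_upwards [hKm.prod_swap.prodMk_left] with h hh
    exact hh.enorm
  have hPh : ∀ h : ℝ, AEMeasurable (fun x => ‖P x - P (x + h)‖ₑ) volume := fun h =>
    (hPm.sub (hPm.comp_measurePreserving (measurePreserving_add_right volume h))).enorm
  refine ENNReal.le_of_sq_le_sq ?_
  -- The weight is shared as 1/2 = s + (1/2 - s); both exponents lie in (0, 1/2), the range of
  -- Hardy's inequality.
  have hpt : ∀ x h, (‖P x - P (x + h)‖ₑ * ‖K (x, x + h)‖ₑ) * (r x)⁻¹ ^ (1 / 2 : ℝ) =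
      ((r x)⁻¹ ^ s * ‖K (x, x + h)‖ₑ) * ((r x)⁻¹ ^ (1 / 2 - s) * ‖P x - P (x + h)‖ₑ) := by
    intro x h
    have : (1 / 2 : ℝ) = s + (1 / 2 - s) := by ring
    rw [this, ENNReal.rpow_add_of_nonneg _ _ hs0.le (by linarith), add_sub_cancel]
    ring
  calc _ = (∫⁻ h, ∫⁻ x, ((r x)⁻¹ ^ s * ‖K (x, x + h)‖ₑ) *
        ((r x)⁻¹ ^ (1 / 2 - s) * ‖P x - P (x + h)‖ₑ)) ^ 2 := by
        congr 1
        simp only [← hpt]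
        have hm : AEMeasurable (fun p : ℝ × ℝ => ‖P p.1 - P (p.1 + p.2)‖ₑ * ‖K (p.1, p.1 + p.2)‖ₑ)
          (volume.prod volume) := hPshift.enorm.mul hKm.enorm
        rw [lintegral_lintegral_swap (f := fun h x => ‖P x - P (x + h)‖ₑ * ‖K (x, x + h)‖ₑ *
          (r x)⁻¹ ^ (1 / 2 : ℝ)) (hm.prod_swap.mul (hr.inv.pow_const _).aemeasurable.comp_snd)]
        refine lintegral_congr_ae ?_
        filter_upwards [hPshift.prodMk_left, hKm.prodMk_left] with x hx1 hx2
        have hx : AEMeasurable (fun h => ‖P x - P (x + h)‖ₑ * ‖K (x, x + h)‖ₑ) volume :=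
          hx1.enorm.mul hx2.enorm
        rw [lintegral_mul_const'' _ hx,
          lintegral_add_left_eq_self (fun y => ‖P x - P y‖ₑ * ‖K (x, y)‖ₑ) x]
    -- Cauchy–Schwarz in x for each h. The inserted powers of |h| have product 1 and anticipate
    -- Cauchy–Schwarz in h, where the first becomes the weight of the kernel norm.
    _ ≤ (∫⁻ h : ℝ, (ENNReal.ofReal (|h| ^ ((1 + 2 * s) / 2)) * (C₁ * γ h) ^ (1 / 2 : ℝ)) *
          (ENNReal.ofReal (|h| ^ (-((1 + 2 * s) / 2))) * (C₂ * 8 * q h) ^ (1 / 2 : ℝ))) ^ 2 := by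
        refine pow_le_pow_left' (lintegral_mono_ae ?_) 2
        have hne : ∀ᵐ h : ℝ, h ≠ 0 := measure_eq_zero_iff_ae_notMem.1 (Real.volume_singleton (a := 0))
        filter_upwards [hsliceK, hsliceP, hKh, hne] with h h1 h2 h3 h0
        have ha : 0 < |h| := abs_pos.2 h0
        have e : ENNReal.ofReal (|h| ^ ((1 + 2 * s) / 2)) *
            ENNReal.ofReal (|h| ^ (-((1 + 2 * s) / 2))) = 1 := by
          rw [← ENNReal.ofReal_mul (by positivity), ← Real.rpow_add ha]; simp
        rw [mul_mul_mul_comm, e, one_mul]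
        refine ENNReal.le_of_sq_le_sq ?_
        rw [mul_pow, ENNReal.sqrt_rpow_sq, ENNReal.sqrt_rpow_sq]
        refine (lintegral_weighted_mul_sq_le h3 (hPh h) (hr.inv.pow_const _).aemeasurable
          (hr.inv.pow_const _).aemeasurable).trans ?_
        simp only [Pi.inv_apply, ENNReal.rpow_sq]
        exact mul_le_mul' h1 h2
    _ ≤ (∫⁻ h : ℝ, ENNReal.ofReal (|h| ^ (1 + 2 * s)) * (C₁ * γ h)) *
          ∫⁻ h : ℝ, ENNReal.ofReal (|h| ^ (-1 - 2 * s)) * (C₂ * 8 * q h) := by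
        have := lintegral_weighted_mul_sq_le ((hγm.const_mul C₁).pow_const (1 / 2 : ℝ))
          ((hqm.aemeasurable.const_mul (C₂ * 8)).pow_const (1 / 2 : ℝ))
          (w₁ := fun h => ENNReal.ofReal (|h| ^ ((1 + 2 * s) / 2)))
          (w₂ := fun h => ENNReal.ofReal (|h| ^ (-((1 + 2 * s) / 2))))
          (Measurable.aemeasurable (by fun_prop)) (Measurable.aemeasurable (by fun_prop))
        simp only [ENNReal.sqrt_rpow_sq] at this
        have e : ∀ h p : ℝ, ENNReal.ofReal (|h| ^ p) ^ 2 = ENNReal.ofReal (|h| ^ (2 * p)) := by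
          intro h p
          rw [← ENNReal.ofReal_pow (by positivity), ← Real.rpow_natCast,
            ← Real.rpow_mul (abs_nonneg _), mul_comm]
          norm_num
        simp only [e] at this
        rw [show 2 * ((1 + 2 * s) / 2) = 1 + 2 * s by ring,
          show 2 * -((1 + 2 * s) / 2) = -1 - 2 * s by ring] at this
        exact this
    _ ≤ (C₁ * MultiComm.kernelNorm (-s) 2 2 G ^ 2) * (C₂ * 8 *
          (ENNReal.ofReal (1 / (1 - 2 * s) + 1 / s) * MultiComm.sobolevHalfSeminorm P ^ 2)) := by
        rw [hkn, hsn]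
        simp only [mul_left_comm (ENNReal.ofReal _) (C₁ : ℝ≥0∞),
          mul_left_comm (ENNReal.ofReal _) ((C₂ : ℝ≥0∞) * 8)]
        rw [lintegral_const_mul' _ _ ENNReal.coe_ne_top, lintegral_const_mul' _ _ (by finiteness)]
        refine mul_le_mul_right (mul_le_mul_right ?_ _) _
        exact lintegral_lintegral_min_le hs0 hs1 hB
    _ = _ := by
        rw [mul_pow, mul_pow, ENNReal.sqrt_rpow_sq, hA]
        ring

theorem commutator_kernel_aestronglyMeasurable {m : ℕ} {K : ℝ × ℝ → Matrix (Fin m) (Fin m) ℝ}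
    {P : ℝ → Matrix (Fin m) (Fin m) ℝ} (hK : AEStronglyMeasurable K volume)
    (hP : AEStronglyMeasurable P volume) :
    AEStronglyMeasurable (fun p : ℝ × ℝ => (P p.1 - P p.2) * (K p)ᵀ) (volume.prod volume) :=
  Matrix.continuous_mul_transpose.comp_aestronglyMeasurable
    (((hP.comp_fst (ν := volume)).sub (hP.comp_snd (μ := volume))).prodMk hK)

/-- An explicit admissible weight, needed to deduce that the absolute integral in y is finite for
a.e. x. -/
theorem volume_two_mul_abs_le (a : ℝ≥0∞) :
    volume {x : ℝ | ENNReal.ofReal (2 * |x|) ≤ a} ≤ a := by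
  rcases eq_or_ne a ∞ with rfl | ha
  · exact le_top
  lift a to ℝ≥0 using ha
  have hsub : {x : ℝ | ENNReal.ofReal (2 * |x|) ≤ a} ⊆ Set.Icc (-(a / 2) : ℝ) (a / 2) := by
    intro x hx
    have hx' : 2 * |x| ≤ a := by
      exact ENNReal.ofReal_le_coe.1 hx
    exact Set.mem_Icc.2 (abs_le.1 (by linarith))
  refine (measure_mono hsub).trans ?_
  rw [Real.volume_Icc, sub_neg_eq_add, add_halves, ENNReal.ofReal_coe_nnreal]

theorem lemma2p1 (σ : ℝ) (hσ0 : 0 < σ) (hσ1 : σ < 1 / 2) :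
    ∃ C : ℝ≥0, ∀ (m : ℕ) (K G : ℝ × ℝ → Matrix (Fin m) (Fin m) ℝ)
      (P : ℝ → Matrix (Fin m) (Fin m) ℝ),
      LocallyIntegrable K volume →
      MultiComm.HasKernelFracLaplacian σ K G →
      MultiComm.kernelNorm (-σ) 2 2 G < ∞ →
      MultiComm.MemSobolevHalf P →
      (∀ᵐ x : ℝ, Integrable (fun y => (P x - P y) * (K (x, y))ᵀ) volume) ∧
      MultiComm.MemLorentz 2 1 (fun x => ∫ y, (P x - P y) * (K (x, y))ᵀ) ∧
      MultiComm.lorentzNorm 2 1 (fun x => ∫ y, (P x - P y) * (K (x, y))ᵀ) ≤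
        (C : ℝ≥0∞) * MultiComm.kernelNorm (-σ) 2 2 G * MultiComm.sobolevHalfSeminorm P := by

  obtain ⟨A, hA⟩ := commutator_weighted_bound hσ0 hσ1
  refine ⟨2 * A, fun m K G P hK hKG hG hP => ?_⟩
  have hbound := hA m K G P hK hKG hG hP
  have hPm : AEStronglyMeasurable P volume := hP.1.aestronglyMeasurable
  have hF := commutator_kernel_aestronglyMeasurable hK.aestronglyMeasurable hPm
  have hTm : AEMeasurable (fun x => ∫⁻ y, ‖P x - P y‖ₑ * ‖K (x, y)‖ₑ) volume := by
    have h : AEMeasurable (fun p : ℝ × ℝ => ‖P p.1 - P p.2‖ₑ * ‖K (p.1, p.2)‖ₑ)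
        (volume.prod volume) :=
      ((hPm.comp_fst (ν := volume)).sub (hPm.comp_snd (μ := volume))).enorm.mul
        hK.aestronglyMeasurable.enorm
    exact h.lintegral_prod_right'
  have hle : ∀ x, ∫⁻ y, ‖(P x - P y) * (K (x, y))ᵀ‖ₑ ≤ ∫⁻ y, ‖P x - P y‖ₑ * ‖K (x, y)‖ₑ :=
    fun x => lintegral_mono fun y => Matrix.enorm_mul_transpose_le _ _
  have hfin : (A : ℝ≥0∞) * MultiComm.kernelNorm (-σ) 2 2 G * MultiComm.sobolevHalfSeminorm P < ∞ :=
    ENNReal.mul_lt_top (ENNReal.mul_lt_top ENNReal.coe_lt_top hG) hP.2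
  have hT : ∀ᵐ x, ∫⁻ y, ‖P x - P y‖ₑ * ‖K (x, y)‖ₑ < ∞ := by
    have hr : Measurable fun x : ℝ => ENNReal.ofReal (2 * |x|) := by fun_prop
    have h := (hbound _ hr volume_two_mul_abs_le).trans_lt hfin
    filter_upwards [ae_lt_top' (hTm.mul (hr.inv.pow_const _).aemeasurable) h.ne] with x hx
    by_contra hc
    -- The weight vanishes nowhere, so a finite weighted product forces the inner integral to be
    -- finite.
    have hpos : (ENNReal.ofReal (2 * |x|))⁻¹ ^ (1 / 2 : ℝ) ≠ 0 :=
      (ENNReal.rpow_pos_of_nonneg (ENNReal.inv_pos.2 ENNReal.ofReal_ne_top) (by norm_num)).ne'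
    rw [Pi.mul_apply, Pi.inv_apply, not_lt_top_iff.1 hc, ENNReal.top_mul hpos] at hx
    exact lt_irrefl _ hx
  have hnorm : MultiComm.lorentzNorm 2 1 (fun x => ∫ y, (P x - P y) * (K (x, y))ᵀ) ≤
      ((2 * A : ℝ≥0) : ℝ≥0∞) * MultiComm.kernelNorm (-σ) 2 2 G *
        MultiComm.sobolevHalfSeminorm P := by
    refine (lorentzNorm_two_one_le_of_forall hTm (Eventually.of_forall fun x =>
      (enorm_integral_le_lintegral_enorm _).trans (hle x)) hbound).trans_eq ?_
    push_cast
    ring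
  refine ⟨?_, ⟨hF.integral_prod_right', hnorm.trans_lt ?_⟩, hnorm⟩
  · filter_upwards [hF.prodMk_left, hT] with x h1 h2
    exact ⟨h1, (hle x).trans_lt h2⟩
  · exact ENNReal.mul_lt_top (ENNReal.mul_lt_top ENNReal.coe_lt_top hG) hP.2
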